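/- Let $\mathscr{M}=(\underline{M},\otimes,I)$ be a symmetric monoidal category. For a set $X$ let $\mathcal{S}_X$ be the strict 2-category whose objects are the elements of $X$, whose 1-morphisms $A\to B$ are the finite chains $s=(A=x_0,x_1,\dots,x_n=B)$ with $n\ge 0$ (composed by concatenation, written $s\otimes t$; the chain $(A)$ of length $0$ is the identity of $A$), and whose 2-morphisms $s\Rightarrow t$ are the monotone surjections from the edges of $s$ to the edges of $t$ that exhibit $t$ as obtained from $s$ by deleting intermediate vertices. The map $X\to 1$ induces the length 2-functor $\mathcal{S}_X\to\mathcal{S}_1\cong(\Delta_{\rm epi},+,0)$. A *unital co-Segal precategory* on $X$ is a normal lax functor $\mathcal{F}:(\mathcal{S}_X)^{2\text{-op}}\to\mathscr{M}$, with laxity maps $\varphi:\mathcal{F}(s)\otimes\mathcal{F}(t)\to\mathcal{F}(s\otimes t)$ and invertible unit comparison maps $I\to\mathcal{F}((A))$, together with maps $I_A: I\to\mathcal{F}(A,A)$, $A\in X$, such that for every chain $s=(A,\dots,B)$ and every 2-morphism $\sigma:s\to(A,A)\otimes s$ of $(\mathcal{S}_X)^{2\text{-op}}$ (resp. $\sigma:s\to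 s\otimes(B,B)$) the composite $I\otimes\mathcal{F}(s)\cong\mathcal{F}(s)\xrightarrow{\mathcal{F}(\sigma)}\mathcal{F}((A,A)\otimes s)$ equals $\varphi\circ(I_A\otimes\mathrm{Id})$ (resp. $\mathcal{F}(s)\otimes I\cong\mathcal{F}(s)\xrightarrow{\mathcal{F}(\sigma)}\mathcal{F}(s\otimes(B,B))$ equals $\varphi\circ(\mathrm{Id}\otimes I_B)$). A morphism of unital precategories on $X$ is a family of maps $\mathcal{F}(s)\to\mathcal{G}(s)$, natural in $s$ and compatible with the laxity maps, the unit comparison maps and the units. Let $\mathscr{M}_{\mathcal{S}}(\mathrm{Set})_{su}$ be the category of pairs $(X,\mathcal{F})$ with $\mathcal{F}$ a unital precategory on the set $X$; a morphism $(X,\mathcal{F})\to(Y,\mathcal{G})$ is a pair $(f,\sigma)$ of a function $f:X\to Y$ and a morphism $\sigma:\mathcal{F}\to f^\star\mathcal{G}$ of unital precategories on $X$. Then the following hold. 1. For all sets $X,Y$ the two projections induce an isomorphism of 2-categories $\mathcal{S}_{X\times Y}\cong\mathcal{S}_X\times_{\mathcal{S}_1}\mathcal{S}_Y$; so a chain in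 $X\times Y$ is a pair $(s,s')$ of chains of equal length in $X$ and $Y$. 2. For $(X,\mathcal{F})$ and $(Y,\mathcal{G})$ let $\mathcal{F}\otimes_{\mathcal{S}}\mathcal{G}$ be the unital precategory on $X\times Y$ with $(\mathcal{F}\otimes_{\mathcal{S}}\mathcal{G})(s,s')=\mathcal{F}(s)\otimes\mathcal{G}(s')$, with laxity maps $$\mathcal{F}(s)\otimes\mathcal{G}(s')\otimes\mathcal{F}(t)\otimes\mathcal{G}(t')\cong\mathcal{F}(s)\otimes\mathcal{F}(t)\otimes\mathcal{G}(s')\otimes\mathcal{G}(t')\xrightarrow{\varphi_{\mathcal{F}}\otimes\varphi_{\mathcal{G}}}\mathcal{F}(s\otimes t)\otimes\mathcal{G}(s'\otimes t')$$ (the first map is the symmetry of $\mathscr{M}$ in the middle factors), and with unit comparison maps and units $I\cong I\otimes I\to(\mathcal{F}\otimes_{\mathcal{S}}\mathcal{G})(-)$ the tensor products of those of $\mathcal{F}$ and $\mathcal{G}$; for morphisms let $(f,\sigma)\otimes_{\mathcal{S}}(g,\tau)$ be $f\times g$ with components $\sigma_s\otimes\tau_{s'}$. Let $\mathbf{1}$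 be the precategory with one object and constant value $I$. Then $(\mathscr{M}_{\mathcal{S}}(\mathrm{Set})_{su},\otimes_{\mathcal{S}},\mathbf{1})$ is a symmetric monoidal category, whose associativity, unit and symmetry isomorphisms are the canonical bijections of products of sets on objects and, on each chain, the corresponding structure isomorphisms of $\mathscr{M}$. 3. Let $\mathscr{M}\text{-}\mathrm{Cat}$ be the category of small $\mathscr{M}$-enriched categories and $\mathscr{M}$-functors with its usual monoidal structure: $\mathcal{C}\boxtimes\mathcal{D}$ has object set $\mathrm{Ob}\,\mathcal{C}\times\mathrm{Ob}\,\mathcal{D}$ and hom-objects $\mathcal{C}(A,B)\otimes\mathcal{D}(A',B')$, and the unit is the one-object category with endomorphisms $I$. Let $\iota:\mathscr{M}\text{-}\mathrm{Cat}\to\mathscr{M}_{\mathcal{S}}(\mathrm{Set})_{su}$ be the inclusion: $\iota(\mathcal{C})(s)=\mathcal{C}(A,B)$ for every chain $s$ of positive length from $A$ to $B$, $\iota(\mathcal{C})((A))=I$, all 2-morphisms act by identities, the laxity maps are given by the composition of $\mathcal{C}$ (and by unit isomorphisms of $\mathscr{M}$ when a chain has length $0$), and the units are the identities of $\mathcal{C}$.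 Then $\iota$ is a (strong) monoidal functor, with the canonical isomorphisms $\mathbf{1}\cong\iota(\text{unit})$ and $\iota(\mathcal{C})\otimes_{\mathcal{S}}\iota(\mathcal{D})\cong\iota(\mathcal{C}\boxtimes\mathcal{D})$ (identities on objects; on chains of positive length identities of $I$ and of $\mathcal{C}(A,B)\otimes\mathcal{D}(A',B')$, on chains of length $0$ the identity of $I$ and $I\otimes I\cong I$). -/

import Mathlib

open CategoryTheory MonoidalCategory

set_option linter.unusedSimpArgs false
universe w v u

namespace CoSegal

/-- A chain `(x₀, ..., xₙ)` of elements of `X` from `A = x₀` to `B = xₙ`, with `len = n ≥ 0`: a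
1-morphism `A ⟶ B` of the strict 2-category `S_X`. The vertices are recorded as a sequence
`ℕ → X` which is constant, equal to `B`, from index `n` on. -/
@[ext]
structure Chain {X : Type w} (A B : X) where
  len : ℕ
  vtx : ℕ → X
  src : vtx 0 = A
  tgt : ∀ i, len ≤ i → vtx i = B

namespace Chain

variable {X : Type w} {Y : Type w} {A B C D : X}

/-- The chain `(A)` of length `0`: the identity 1-morphism of `A`. -/
abbrev nil (A : X) : Chain A A := ⟨0, fun _ => A, rfl, fun _ _ => rfl⟩

/-- The chain `(A, B)` of length `1`. -/
abbrev edge (A B : X) : Chain A B :=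
  ⟨1, fun i => if i = 0 then A else B, rfl, fun i hi => if_neg (by omega)⟩

/-- Concatenation `s ⊗ t` of chains: the composition of 1-morphisms. -/
abbrev concat (s : Chain A B) (t : Chain B C) : Chain A C where
  len := s.len + t.len
  vtx i := if i ≤ s.len then s.vtx i else t.vtx (i - s.len)
  src := by simpa using s.src
  tgt i hi := by
    split_ifs with h
    · rw [s.tgt i (by omega), ← t.src, t.tgt 0 (by omega)]
    · exact t.tgt _ (by omega)

theorem concat_vtx_left (s : Chain A B) (t : Chain B C) (i : ℕ)
    (h : i ≤ s.len) : (s.concat t).vtx i = s.vtx i :=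
  if_pos h

theorem concat_vtx_right (s : Chain A B) (t : Chain B C) (i : ℕ)
    (h : s.len ≤ i) : (s.concat t).vtx i = t.vtx (i - s.len) := by
  by_cases h' : i ≤ s.len
  · rw [concat_vtx_left s t i h']
    obtain rfl : i = s.len := le_antisymm h' h
    rw [Nat.sub_self, t.src, s.tgt _ le_rfl]
  · exact if_neg h'

/-- A 2-morphism `s ⟶ t` of `S_X`: a monotone surjection from the edges of `s` to the edges of `t`
(a morphism of the category `Δ_epi` of finite ordinals) exhibiting `t` as the chain obtained from
`s` by deleting vertices: the source of an edge of `t` is the source of the first edge of `s`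
lying over it. -/
@[ext]
structure Coll (s t : Chain A B) where
  toFun : Fin s.len → Fin t.len
  mono : Monotone toFun
  surj : Function.Surjective toFun
  vtx_eq : ∀ i, (∀ k, toFun k = toFun i → i ≤ k) → t.vtx (toFun i) = s.vtx i

namespace Coll

def id (s : Chain A B) : Coll s s :=
  ⟨fun i => i, fun _ _ h => h, fun i => ⟨i, rfl⟩, fun _ _ => rfl⟩

def comp {r s t : Chain A B} (f : Coll r s) (g : Coll s t) : Coll r t where
  toFun i := g.toFun (f.toFun i)
  mono := g.mono.comp f.mono
  surj := g.surj.comp f.surj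
  vtx_eq i hi := by
    rw [g.vtx_eq, f.vtx_eq]
    · intro k hk
      exact hi k (by rw [hk])
    · intro k hk
      obtain ⟨k, rfl⟩ := f.surj k
      exact f.mono (hi k hk)

/-- Horizontal composition of 2-morphisms: ordinal sum. -/
def concat {s s' : Chain A B} {t t' : Chain B C} (f : Coll s s') (g : Coll t t') :
    Coll (s.concat t) (s'.concat t') where
  toFun i := if h : (i : ℕ) < s.len then
      ⟨f.toFun ⟨i, h⟩, Nat.lt_add_right _ (Fin.isLt _)⟩
    else ⟨s'.len + g.toFun ⟨i - s.len, Nat.sub_lt_left_of_lt_add (not_lt.1 h) i.2⟩, Nat.add_lt_add_left (Fin.isLt _) _⟩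
  mono i j hij := by
    have hij' : (i : ℕ) ≤ j := hij
    rw [Fin.le_def]
    dsimp only
    split_ifs with h1 h2 h2
    · exact f.mono (show (⟨i, h1⟩ : Fin s.len) ≤ ⟨j, h2⟩ from hij')
    · dsimp only; omega
    · omega
    · exact Nat.add_le_add_left (g.mono (show (⟨i - s.len, _⟩ : Fin t.len) ≤ ⟨j - s.len, _⟩ from
        Nat.sub_le_sub_right hij' _)) _
  surj j := by
    have hj : (j : ℕ) < s'.len + t'.len := j.2
    by_cases h : (j : ℕ) < s'.len
    · obtain ⟨i, hi⟩ := f.surj ⟨j, h⟩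
      exact ⟨⟨i, Nat.lt_add_right _ i.2⟩, by simp [hi]⟩
    · obtain ⟨i, hi⟩ := g.surj ⟨j - s'.len, by omega⟩
      refine ⟨⟨s.len + i, Nat.add_lt_add_left i.2 _⟩, ?_⟩
      ext
      simp [hi]
      omega
  vtx_eq i hi := by
    by_cases h : (i : ℕ) < s.len
    · simp only [dif_pos h]
      rw [if_pos (Fin.isLt _).le, if_pos h.le]
      refine f.vtx_eq ⟨i, h⟩ fun k hk => ?_
      have := hi ⟨k, Nat.lt_add_right _ k.2⟩ (by simp [h, hk])
      exact this
    · have hil : (i : ℕ) < s.len + t.len := i.2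
      simp only [dif_neg h]
      have e := g.vtx_eq ⟨i - s.len, by omega⟩ fun k hk => by
        have := hi ⟨s.len + k, Nat.add_lt_add_left k.2 _⟩ (by simp [h, hk])
        rw [Fin.le_def] at this ⊢
        dsimp only at this ⊢
        omega
      refine (concat_vtx_right s' t' _ (Nat.le_add_right _ _)).trans
        (Eq.trans ?_ (concat_vtx_right s t i (by omega)).symm)
      rw [Nat.add_sub_cancel_left]
      exact e

end Coll

/-- The hom-category of `(S_X)^{2-op}`, i.e. `S_X(A, B)` with reversed 2-morphisms: a morphism
`s ⟶ t` here is a collapse of `t` onto `s`. -/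
instance : Category (Chain A B) where
  Hom s t := Coll t s
  id s := Coll.id s
  comp f g := Coll.comp g f

namespace Coll

/-- The action of a collapse on edges, extended to all of `ℕ` (an auxiliary tool for extensionality). -/
def ap {s t : Chain A B} (f : Coll s t) (i : ℕ) : ℕ :=
  if h : i < s.len then f.toFun ⟨i, h⟩ else t.len + (i - s.len)

theorem ap_of_lt {s t : Chain A B} (f : Coll s t) {i : ℕ} (h : i < s.len) :
    f.ap i = f.toFun ⟨i, h⟩ :=
  dif_pos h

theorem ap_of_le {s t : Chain A B} (f : Coll s t) {i : ℕ} (h : s.len ≤ i) :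
    f.ap i = t.len + (i - s.len) :=
  dif_neg (not_lt.2 h)

theorem ap_lt {s t : Chain A B} (f : Coll s t) {i : ℕ} (h : i < s.len) : f.ap i < t.len := by
  rw [ap_of_lt f h]; exact Fin.isLt _

theorem ext_ap {s t : Chain A B} {f g : Coll s t} (h : ∀ i, f.ap i = g.ap i) : f = g := by
  ext i
  rw [← ap_of_lt f i.2, ← ap_of_lt g i.2, h]

theorem ap_id (s : Chain A B) (i : ℕ) : (Coll.id s).ap i = i := by
  unfold ap
  split_ifs with h
  · rfl
  · omega

theorem ap_concat {s s' : Chain A B} {t t' : Chain B C} (f : Coll s s') (g : Coll t t') (i : ℕ) :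
    (f.concat g).ap i = if i < s.len then f.ap i else s'.len + g.ap (i - s.len) := by
  by_cases h : i < s.len + t.len
  · rw [ap_of_lt _ h]
    by_cases h1 : i < s.len
    · simp [concat, h1, ap_of_lt]
    · have h2 : i - s.len < t.len := by omega
      simp [concat, h1, ap_of_lt _ h2]
  · rw [ap_of_le _ (not_lt.1 h), ap_of_le g (by omega), if_neg (by omega)]
    dsimp only
    omega

end Coll

theorem ap_id' (s : Chain A B) (i : ℕ) : Coll.ap (𝟙 s) i = i := Coll.ap_id s i

theorem ap_comp {r s t : Chain A B} (f : r ⟶ s) (g : s ⟶ t) (i : ℕ) :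
    Coll.ap (f ≫ g) i = Coll.ap f (Coll.ap g i) := by
  by_cases h : i < t.len
  · have h' := Coll.ap_lt g h
    rw [Coll.ap_of_lt f h', Coll.ap_of_lt _ h]
    simp only [Coll.ap_of_lt g h]
    rfl
  · rw [Coll.ap_of_le _ (not_lt.1 h), Coll.ap_of_le g (not_lt.1 h), Coll.ap_of_le f (by omega)]
    omega

theorem ap_eqToHom {s t : Chain A B} (h : s = t) (i : ℕ) : Coll.ap (eqToHom h) i = i := by
  subst h; exact ap_id' s i

theorem hom_ext {s t : Chain A B} {f g : s ⟶ t} (h : ∀ i, Coll.ap f i = Coll.ap g i) : f = g :=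
  Coll.ext_ap h

theorem nil_concat (s : Chain A B) : (nil A).concat s = s := by
  ext i
  · simp
  · rw [concat_vtx_right _ _ _ (by simp)]
    simp

theorem concat_nil (s : Chain A B) : s.concat (nil B) = s := by
  ext i
  · simp
  · by_cases h : i ≤ s.len
    · simp [h]
    · simp [h, s.tgt i (by omega)]

theorem concat_assoc (r : Chain A B) (s : Chain B C) (t : Chain C D) :
    (r.concat s).concat t = r.concat (s.concat t) := by
  ext i
  · simp [add_assoc]
  · dsimp only
    split_ifs <;> first | rfl | omega | (congr 1; omega)

/-- The image of a chain under a function. -/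
abbrev map (f : X → Y) (s : Chain A B) : Chain (f A) (f B) where
  len := s.len
  vtx i := f (s.vtx i)
  src := congrArg f s.src
  tgt i hi := congrArg f (s.tgt i hi)

/-- The image of a collapse under a function. -/
def mapColl (f : X → Y) {s t : Chain A B} (σ : Coll s t) : Coll (s.map f) (t.map f) where
  toFun := σ.toFun
  mono := σ.mono
  surj := σ.surj
  vtx_eq i hi := congrArg f (σ.vtx_eq i hi)

/-- The image of a 2-morphism of `(S_X)^{2-op}` under a function. -/
abbrev mapHom (f : X → Y) {s t : Chain A B} (σ : s ⟶ t) : s.map f ⟶ t.map f := mapColl f σ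

theorem map_concat (f : X → Y) (s : Chain A B) (t : Chain B C) :
    (s.concat t).map f = (s.map f).concat (t.map f) := by
  ext i
  · rfl
  · exact apply_ite f _ _ _

theorem ap_mapHom (f : X → Y) {s t : Chain A B} (σ : s ⟶ t) (i : ℕ) :
    Coll.ap (mapHom f σ) i = Coll.ap σ i := rfl

theorem mapHom_eqToHom (f : X → Y) {s t : Chain A B} (h : s = t) :
    mapHom f (eqToHom h) = eqToHom (congrArg (map f) h) := by
  subst h; rfl

theorem map_edge (f : X → Y) (A B : X) : (edge A B).map f = edge (f A) (f B) := by
  ext i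
  · rfl
  · exact apply_ite f _ _ _

end Chain

/-- The objects of the strict 2-category `(S_X)^{2-op}`: the elements of `X`. -/
structure SOp (X : Type w) where
  pt : X

namespace SOp

variable {X : Type w} {Y : Type w}

/-- The strict 2-category `(S_X)^{2-op}`. -/
instance : Bicategory (SOp X) where
  Hom a b := Chain a.pt b.pt
  id a := Chain.nil a.pt
  comp s t := s.concat t
  whiskerLeft s _ _ τ := Chain.Coll.concat (Chain.Coll.id s) τ
  whiskerRight σ t := Chain.Coll.concat σ (Chain.Coll.id t)
  associator r s t := eqToIso (Chain.concat_assoc r s t)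
  leftUnitor s := eqToIso (Chain.nil_concat s)
  rightUnitor s := eqToIso (Chain.concat_nil s)
  whiskerLeft_id := by
    intros
    refine Chain.hom_ext fun i => ?_
    simp only [Chain.ap_comp, Chain.ap_id', Chain.ap_eqToHom, Chain.Coll.ap_concat,
      Chain.Coll.ap_id, eqToIso.hom, eqToIso.inv]
    grind [Chain.Coll.ap_lt, Chain.Coll.ap_of_le]
  whiskerLeft_comp := by
    intros
    refine Chain.hom_ext fun i => ?_
    simp only [Chain.ap_comp, Chain.ap_id', Chain.ap_eqToHom, Chain.Coll.ap_concat,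
      Chain.Coll.ap_id, eqToIso.hom, eqToIso.inv]
    grind [Chain.Coll.ap_lt, Chain.Coll.ap_of_le]
  id_whiskerLeft := by
    intros
    refine Chain.hom_ext fun i => ?_
    simp only [Chain.ap_comp, Chain.ap_id', Chain.ap_eqToHom, Chain.Coll.ap_concat,
      Chain.Coll.ap_id, eqToIso.hom, eqToIso.inv]
    grind [Chain.Coll.ap_lt, Chain.Coll.ap_of_le]
  comp_whiskerLeft := by
    intros
    refine Chain.hom_ext fun i => ?_
    simp only [Chain.ap_comp, Chain.ap_id', Chain.ap_eqToHom, Chain.Coll.ap_concat,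
      Chain.Coll.ap_id, eqToIso.hom, eqToIso.inv]
    grind [Chain.Coll.ap_lt, Chain.Coll.ap_of_le]
  id_whiskerRight := by
    intros
    refine Chain.hom_ext fun i => ?_
    simp only [Chain.ap_comp, Chain.ap_id', Chain.ap_eqToHom, Chain.Coll.ap_concat,
      Chain.Coll.ap_id, eqToIso.hom, eqToIso.inv]
    grind [Chain.Coll.ap_lt, Chain.Coll.ap_of_le]
  comp_whiskerRight := by
    intros
    refine Chain.hom_ext fun i => ?_
    simp only [Chain.ap_comp, Chain.ap_id', Chain.ap_eqToHom, Chain.Coll.ap_concat,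
      Chain.Coll.ap_id, eqToIso.hom, eqToIso.inv]
    grind [Chain.Coll.ap_lt, Chain.Coll.ap_of_le]
  whiskerRight_id := by
    intros
    refine Chain.hom_ext fun i => ?_
    simp only [Chain.ap_comp, Chain.ap_id', Chain.ap_eqToHom, Chain.Coll.ap_concat,
      Chain.Coll.ap_id, eqToIso.hom, eqToIso.inv]
    grind [Chain.Coll.ap_lt, Chain.Coll.ap_of_le]
  whiskerRight_comp := by
    intros
    refine Chain.hom_ext fun i => ?_
    simp only [Chain.ap_comp, Chain.ap_id', Chain.ap_eqToHom, Chain.Coll.ap_concat,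
      Chain.Coll.ap_id, eqToIso.hom, eqToIso.inv]
    grind [Chain.Coll.ap_lt, Chain.Coll.ap_of_le]
  whisker_assoc := by
    intros
    refine Chain.hom_ext fun i => ?_
    simp only [Chain.ap_comp, Chain.ap_id', Chain.ap_eqToHom, Chain.Coll.ap_concat,
      Chain.Coll.ap_id, eqToIso.hom, eqToIso.inv]
    grind [Chain.Coll.ap_lt, Chain.Coll.ap_of_le]
  whisker_exchange := by
    intros
    refine Chain.hom_ext fun i => ?_
    simp only [Chain.ap_comp, Chain.ap_id', Chain.ap_eqToHom, Chain.Coll.ap_concat,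
      Chain.Coll.ap_id, eqToIso.hom, eqToIso.inv]
    grind [Chain.Coll.ap_lt, Chain.Coll.ap_of_le]
  pentagon := by
    intros
    refine Chain.hom_ext fun i => ?_
    simp only [Chain.ap_comp, Chain.ap_id', Chain.ap_eqToHom, Chain.Coll.ap_concat,
      Chain.Coll.ap_id, eqToIso.hom, eqToIso.inv]
    grind [Chain.Coll.ap_lt, Chain.Coll.ap_of_le]
  triangle := by
    intros
    refine Chain.hom_ext fun i => ?_
    simp only [Chain.ap_comp, Chain.ap_id', Chain.ap_eqToHom, Chain.Coll.ap_concat,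
      Chain.Coll.ap_id, eqToIso.hom, eqToIso.inv]
    grind [Chain.Coll.ap_lt, Chain.Coll.ap_of_le]


/-- A chain as a 1-morphism of `(S_X)^{2-op}`. -/
abbrev oneCell {A B : X} (s : Chain A B) : (⟨A⟩ : SOp X) ⟶ ⟨B⟩ := s

instance : Bicategory.Strict (SOp X) where
  id_comp s := Chain.nil_concat s
  comp_id s := Chain.concat_nil s
  assoc r s t := Chain.concat_assoc r s t

/-- The data of the strict 2-functor induced by a function. -/
def mapCore (f : X → Y) : StrictPseudofunctorPreCore (SOp X) (SOp Y) where
  obj a := ⟨f a.pt⟩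
  map s := Chain.map f s
  map₂ σ := Chain.mapColl f σ
  map_comp s t := Chain.map_concat f s t
  map₂_whisker_left s _ _ τ := by
    refine Chain.hom_ext fun i => ?_
    rw [Chain.ap_comp, Chain.ap_comp, Chain.ap_eqToHom, Chain.ap_eqToHom]
    rfl
  map₂_whisker_right σ t := by
    refine Chain.hom_ext fun i => ?_
    rw [Chain.ap_comp, Chain.ap_comp, Chain.ap_eqToHom, Chain.ap_eqToHom]
    rfl

/-- The strict 2-functor `(S_X)^{2-op} ⟶ (S_Y)^{2-op}` induced by a function `X → Y`. -/
def map (f : X → Y) : StrictPseudofunctor (SOp X) (SOp Y) := StrictPseudofunctor.mk'' (mapCore f)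

/-- The degree (length) 2-functor `(S_X)^{2-op} ⟶ (S_1)^{2-op}`, induced by the map to a point. -/
abbrev deg (X : Type w) : StrictPseudofunctor (SOp X) (SOp PUnit.{w + 1}) := map fun _ => PUnit.unit

/-- The projection `(S_{X × Y})^{2-op} ⟶ (S_X)^{2-op}`. -/
abbrev pr₁ (X Y : Type w) : StrictPseudofunctor (SOp (X × Y)) (SOp X) := map Prod.fst

/-- The projection `(S_{X × Y})^{2-op} ⟶ (S_Y)^{2-op}`. -/
abbrev pr₂ (X Y : Type w) : StrictPseudofunctor (SOp (X × Y)) (SOp Y) := map Prod.snd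

/-- The 2-functor `S_{X × Y} ⟶ S_X ×_{S_1} S_Y` given by the two projections is well defined and an
isomorphism of 2-categories, i.e. it is bijective on objects, on 1-morphisms and on 2-morphisms. -/
structure IsFibreProduct (X Y : Type w) : Prop where
  obj : ∀ (a : SOp X) (b : SOp Y), (deg X).obj a = (deg Y).obj b →
    ∃! c : SOp (X × Y), (pr₁ X Y).obj c = a ∧ (pr₂ X Y).obj c = b
  deg_obj : ∀ c : SOp (X × Y), (deg X).obj ((pr₁ X Y).obj c) = (deg Y).obj ((pr₂ X Y).obj c)
  map : ∀ (c d : SOp (X × Y)) (s : (pr₁ X Y).obj c ⟶ (pr₁ X Y).obj d)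
    (t : (pr₂ X Y).obj c ⟶ (pr₂ X Y).obj d), (deg X).map s = (deg Y).map t →
    ∃! z : c ⟶ d, (pr₁ X Y).map z = s ∧ (pr₂ X Y).map z = t
  deg_map : ∀ {c d : SOp (X × Y)} (z : c ⟶ d),
    (deg X).map ((pr₁ X Y).map z) = (deg Y).map ((pr₂ X Y).map z)
  map₂ : ∀ {c d : SOp (X × Y)} (z z' : c ⟶ d) (σ : (pr₁ X Y).map z ⟶ (pr₁ X Y).map z')
    (τ : (pr₂ X Y).map z ⟶ (pr₂ X Y).map z'), (deg X).map₂ σ = (deg Y).map₂ τ →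
    ∃! ρ : z ⟶ z', (pr₁ X Y).map₂ ρ = σ ∧ (pr₂ X Y).map₂ ρ = τ
  deg_map₂ : ∀ {c d : SOp (X × Y)} {z z' : c ⟶ d} (ρ : z ⟶ z'),
    (deg X).map₂ ((pr₁ X Y).map₂ ρ) = (deg Y).map₂ ((pr₂ X Y).map₂ ρ)

end SOp

namespace Chain

variable {X : Type w} {A B C D : X}

/-- Horizontal composition of 2-morphisms of `(S_X)^{2-op}`. -/
abbrev hconcat {s s' : Chain A B} {t t' : Chain B C} (σ : s ⟶ s') (τ : t ⟶ t') :
    s.concat t ⟶ s'.concat t' :=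
  Coll.concat σ τ

theorem hconcat_split {s s' : Chain A B} {t t' : Chain B C} (σ : s ⟶ s') (τ : t ⟶ t') :
    hconcat σ τ = hconcat σ (𝟙 t) ≫ hconcat (𝟙 s') τ := by
  refine hom_ext fun i => ?_
  rw [ap_comp]
  simp only [Coll.ap_concat, ap_id']
  grind [Coll.ap_lt, Coll.ap_of_le]

end Chain

variable (M : Type u) [Category.{v} M] [MonoidalCategory M]

/-- A co-Segal precategory with set of objects `X`: a normal lax functor from `(S_X)^{2-op}` to the
monoidal category `M` viewed as a bicategory with one object, written out (see `equivLax`).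
`mu` are the laxity maps, `eps` the unit comparison maps `I ⟶ F(A)` of the identity chains;
normality says that the latter are isomorphisms. -/
@[ext]
structure Precat (X : Type w) where
  val : ∀ {A B : X}, Chain A B → M
  res : ∀ {A B : X} {s t : Chain A B}, (s ⟶ t) → (val s ⟶ val t)
  res_id : ∀ {A B : X} (s : Chain A B), res (𝟙 s) = 𝟙 (val s)
  res_comp : ∀ {A B : X} {r s t : Chain A B} (σ : r ⟶ s) (τ : s ⟶ t),
    res (σ ≫ τ) = res σ ≫ res τ
  mu : ∀ {A B C : X} (s : Chain A B) (t : Chain B C), val s ⊗ val t ⟶ val (s.concat t)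
  mu_natural : ∀ {A B C : X} {s s' : Chain A B} {t t' : Chain B C} (σ : s ⟶ s') (τ : t ⟶ t'),
    mu s t ≫ res (Chain.hconcat σ τ) = (res σ ⊗ₘ res τ) ≫ mu s' t'
  mu_assoc : ∀ {A B C D : X} (r : Chain A B) (s : Chain B C) (t : Chain C D),
    mu r s ▷ val t ≫ mu (r.concat s) t ≫ res (eqToHom (Chain.concat_assoc r s t)) =
      (α_ (val r) (val s) (val t)).hom ≫ val r ◁ mu s t ≫ mu r (s.concat t)
  eps : ∀ A : X, 𝟙_ M ⟶ val (Chain.nil A)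
  eps_left : ∀ {A B : X} (s : Chain A B), res (eqToHom (Chain.nil_concat s).symm) =
    (λ_ (val s)).inv ≫ eps A ▷ val s ≫ mu (Chain.nil A) s
  eps_right : ∀ {A B : X} (s : Chain A B), res (eqToHom (Chain.concat_nil s).symm) =
    (ρ_ (val s)).inv ≫ val s ◁ eps B ≫ mu s (Chain.nil B)
  eps_iso : ∀ A : X, IsIso (eps A)

namespace Precat

variable {M} {X Y : Type w}

attribute [simp] res_id

theorem mu_natural_assoc (F : Precat M X) {A B C : X} {s s' : Chain A B} {t t' : Chain B C}
    (σ : s ⟶ s') (τ : t ⟶ t') {Z : M} (h : F.val (s'.concat t') ⟶ Z) :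
    F.mu s t ≫ F.res (Chain.hconcat σ τ) ≫ h = (F.res σ ⊗ₘ F.res τ) ≫ F.mu s' t' ≫ h := by
  simpa only [Category.assoc] using F.mu_natural σ τ =≫ h

theorem mu_assoc_assoc (F : Precat M X) {A B C D : X} (r : Chain A B) (s : Chain B C)
    (t : Chain C D) {Z : M} (h : F.val (r.concat (s.concat t)) ⟶ Z) :
    F.mu r s ▷ F.val t ≫ F.mu (r.concat s) t ≫ F.res (eqToHom (Chain.concat_assoc r s t)) ≫ h =
      (α_ (F.val r) (F.val s) (F.val t)).hom ≫ F.val r ◁ F.mu s t ≫ F.mu r (s.concat t) ≫ h := by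
  simpa only [Category.assoc] using F.mu_assoc r s t =≫ h

instance (F : Precat M X) (A : X) : IsIso (F.eps A) := F.eps_iso A

/-- The lax functor underlying a precategory. -/
def toLax (F : Precat M X) : LaxFunctor (SOp X) (MonoidalSingleObj M) where
  obj _ := MonoidalSingleObj.star M
  map s := F.val s
  map₂ σ := F.res σ
  map₂_id s := F.res_id s
  map₂_comp σ τ := F.res_comp σ τ
  mapId a := F.eps a.pt
  mapComp s t := F.mu s t
  mapComp_naturality_left σ t :=
    (F.mu_natural σ (𝟙 t)).trans (by rw [F.res_id]; exact congrArg (· ≫ _) (tensorHom_id _ _))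
  mapComp_naturality_right s _ _ τ :=
    (F.mu_natural (𝟙 s) τ).trans (by rw [F.res_id]; exact congrArg (· ≫ _) (id_tensorHom _ _))
  map₂_associator r s t := F.mu_assoc r s t
  map₂_leftUnitor s := F.eps_left s
  map₂_rightUnitor s := F.eps_right s

/-- Precategories are the same as normal lax functors `(S_X)^{2-op} ⟶ M` in the sense of Mathlib. -/
def equivLax : Precat M X ≃
    {L : LaxFunctor (SOp X) (MonoidalSingleObj M) // ∀ a, IsIso (L.mapId a)} where
  toFun F := ⟨F.toLax, fun a => F.eps_iso a.pt⟩
  invFun L :=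
    { val := fun s => L.1.map (SOp.oneCell s)
      res := fun {A B} s t σ => L.1.map₂ (a := ⟨A⟩) (b := ⟨B⟩) σ
      res_id := fun s => L.1.map₂_id (SOp.oneCell s)
      res_comp := fun {A B} _ _ _ σ τ => L.1.map₂_comp (a := ⟨A⟩) (b := ⟨B⟩) σ τ
      mu := fun s t => L.1.mapComp (SOp.oneCell s) (SOp.oneCell t)
      mu_natural := fun {A B C} s s' t t' σ τ => by
        have hl := L.1.mapComp_naturality_left (a := ⟨A⟩) (b := ⟨B⟩) (c := ⟨C⟩) σ t
        have hr := L.1.mapComp_naturality_right (a := ⟨A⟩) (b := ⟨B⟩) (c := ⟨C⟩) s' τ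
        have hc := L.1.map₂_comp (a := ⟨A⟩) (b := ⟨C⟩) (Chain.hconcat σ (𝟙 t))
          (Chain.hconcat (𝟙 s') τ)
        rw [Chain.hconcat_split, MonoidalCategory.tensorHom_def, Category.assoc]
        refine (congrArg (_ ≫ ·) hc).trans ?_
        refine (Category.assoc _ _ _).symm.trans ?_
        refine (congrArg (· ≫ _) hl).trans ?_
        refine (Category.assoc _ _ _).trans ?_
        exact congrArg (_ ≫ ·) hr
      mu_assoc := fun r s t =>
        L.1.map₂_associator (SOp.oneCell r) (SOp.oneCell s) (SOp.oneCell t)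
      eps := fun A => L.1.mapId ⟨A⟩
      eps_left := fun s => L.1.map₂_leftUnitor (SOp.oneCell s)
      eps_right := fun s => L.1.map₂_rightUnitor (SOp.oneCell s)
      eps_iso := fun A => L.2 ⟨A⟩ }
  left_inv _ := rfl
  right_inv _ := rfl

instance {A B : X} {s t : Chain A B} (h : s = t) (F : Precat M X) :
    IsIso (F.res (eqToHom h)) := by
  subst h; rw [eqToHom_refl, res_id]; infer_instance

theorem mu_left (F : Precat M X) {A B C : X} {s s' : Chain A B} (σ : s ⟶ s') (t : Chain B C) :
    F.mu s t ≫ F.res (Chain.hconcat σ (𝟙 t)) = F.res σ ▷ F.val t ≫ F.mu s' t := by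
  rw [F.mu_natural, F.res_id, tensorHom_id]

theorem mu_left_assoc (F : Precat M X) {A B C : X} {s s' : Chain A B} (σ : s ⟶ s')
    (t : Chain B C) {Z : M} (h : F.val (s'.concat t) ⟶ Z) :
    F.mu s t ≫ F.res (Chain.hconcat σ (𝟙 t)) ≫ h = F.res σ ▷ F.val t ≫ F.mu s' t ≫ h := by
  simpa only [Category.assoc] using F.mu_left σ t =≫ h

theorem mu_right (F : Precat M X) {A B C : X} (s : Chain A B) {t t' : Chain B C} (τ : t ⟶ t') :
    F.mu s t ≫ F.res (Chain.hconcat (𝟙 s) τ) = F.val s ◁ F.res τ ≫ F.mu s t' := by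
  rw [F.mu_natural, F.res_id, id_tensorHom]

theorem mu_right_assoc (F : Precat M X) {A B C : X} (s : Chain A B) {t t' : Chain B C}
    (τ : t ⟶ t') {Z : M} (h : F.val (s.concat t') ⟶ Z) :
    F.mu s t ≫ F.res (Chain.hconcat (𝟙 s) τ) ≫ h = F.val s ◁ F.res τ ≫ F.mu s t' ≫ h := by
  simpa only [Category.assoc] using F.mu_right s τ =≫ h

/-- The pullback `f^* F` of a precategory along a function on objects. -/
abbrev pullback (f : X → Y) (F : Precat M Y) : Precat M X where
  val s := F.val (s.map f)
  res σ := F.res (Chain.mapHom f σ)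
  res_id s := F.res_id (s.map f)
  res_comp σ τ := F.res_comp (Chain.mapHom f σ) (Chain.mapHom f τ)
  mu s t := F.mu (s.map f) (t.map f) ≫ F.res (eqToHom (Chain.map_concat f s t).symm)
  mu_natural {A B C s s' t t'} σ τ := by
    rw [Category.assoc, ← F.mu_natural_assoc, ← F.res_comp, ← F.res_comp]
    congr 2
    refine Chain.hom_ext fun i => ?_
    rw [Chain.ap_comp, Chain.ap_comp, Chain.ap_eqToHom, Chain.ap_eqToHom]
    rfl
  mu_assoc r s t := by
    simp only [comp_whiskerRight, MonoidalCategory.whiskerLeft_comp, Category.assoc,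
      ← F.mu_left_assoc, ← F.mu_right_assoc, ← F.mu_assoc_assoc, ← F.res_comp]
    congr 3
    refine Chain.hom_ext fun i => ?_
    simp only [Chain.ap_comp, Chain.Coll.ap_concat, Chain.ap_eqToHom, Chain.ap_id',
      Chain.ap_mapHom]
    grind
  eps A := F.eps (f A)
  eps_left s := by
    simp only [← Category.assoc]
    rw [Category.assoc (λ_ _).inv, ← F.eps_left, ← F.res_comp]
    congr 1
    refine Chain.hom_ext fun i => ?_
    simp only [Chain.ap_comp, Chain.ap_eqToHom, Chain.ap_mapHom]
  eps_right s := by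
    simp only [← Category.assoc]
    rw [Category.assoc (ρ_ _).inv, ← F.eps_right, ← F.res_comp]
    congr 1
    refine Chain.hom_ext fun i => ?_
    simp only [Chain.ap_comp, Chain.ap_eqToHom, Chain.ap_mapHom]
  eps_iso A := F.eps_iso (f A)

end Precat

/-- A (strongly) unital precategory: a precategory with units `I_A : I ⟶ F(A, A)` such that the unit
squares commute for any chain `s` and any 2-morphism `s ⟶ (A, A) ⊗ s`, resp. `s ⟶ s ⊗ (B, B)`. -/
structure UPrecat (X : Type w) extends Precat M X where
  one (A : X) : 𝟙_ M ⟶ toPrecat.val (Chain.edge A A)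
  one_left : ∀ {A B : X} (s : Chain A B) (σ : s ⟶ (Chain.edge A A).concat s),
    (λ_ (toPrecat.val s)).hom ≫ toPrecat.res σ =
      one A ▷ toPrecat.val s ≫ toPrecat.mu (Chain.edge A A) s
  one_right : ∀ {A B : X} (s : Chain A B) (σ : s ⟶ s.concat (Chain.edge B B)),
    (ρ_ (toPrecat.val s)).hom ≫ toPrecat.res σ =
      toPrecat.val s ◁ one B ≫ toPrecat.mu s (Chain.edge B B)

namespace UPrecat

variable {M} {X : Type w} {Y : Type w}

/-- A morphism of unital precategories with the same objects: a family of maps, natural in the chain,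
compatible with the laxity and unit comparison maps, that takes units to units. -/
@[ext]
structure Hom (F G : UPrecat M X) where
  app : ∀ {A B : X} (s : Chain A B), F.val s ⟶ G.val s
  naturality : ∀ {A B : X} {s t : Chain A B} (σ : s ⟶ t), F.res σ ≫ app t = app s ≫ G.res σ
  app_mu : ∀ {A B C : X} (s : Chain A B) (t : Chain B C),
    F.mu s t ≫ app (s.concat t) = (app s ⊗ₘ app t) ≫ G.mu s t
  app_eps : ∀ A : X, F.eps A ≫ app (Chain.nil A) = G.eps A
  app_one : ∀ A : X, F.one A ≫ app (Chain.edge A A) = G.one A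

theorem Hom.naturality_assoc {F G : UPrecat M X} (φ : Hom F G) {A B : X} {s t : Chain A B}
    (σ : s ⟶ t) {Z : M} (h : G.val t ⟶ Z) :
    F.res σ ≫ φ.app t ≫ h = φ.app s ≫ G.res σ ≫ h := by
  simpa only [Category.assoc] using φ.naturality σ =≫ h

theorem Hom.app_mu_assoc {F G : UPrecat M X} (φ : Hom F G) {A B C : X} (s : Chain A B)
    (t : Chain B C) {Z : M} (h : G.val (s.concat t) ⟶ Z) :
    F.mu s t ≫ φ.app (s.concat t) ≫ h = (φ.app s ⊗ₘ φ.app t) ≫ G.mu s t ≫ h := by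
  simpa only [Category.assoc] using φ.app_mu s t =≫ h

theorem Hom.app_eps_assoc {F G : UPrecat M X} (φ : Hom F G) (A : X) {Z : M}
    (h : G.val (Chain.nil A) ⟶ Z) : F.eps A ≫ φ.app (Chain.nil A) ≫ h = G.eps A ≫ h := by
  simpa only [Category.assoc] using φ.app_eps A =≫ h

theorem Hom.app_one_assoc {F G : UPrecat M X} (φ : Hom F G) (A : X) {Z : M}
    (h : G.val (Chain.edge A A) ⟶ Z) : F.one A ≫ φ.app (Chain.edge A A) ≫ h = G.one A ≫ h := by
  simpa only [Category.assoc] using φ.app_one A =≫ h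

instance : Category (UPrecat M X) where
  Hom F G := Hom F G
  id F := ⟨fun s => 𝟙 (F.val s), by simp, by simp, by simp, by simp⟩
  comp σ τ := ⟨fun s => σ.app s ≫ τ.app s,
    fun ρ => by rw [σ.naturality_assoc, τ.naturality, Category.assoc],
    fun s t => by
      rw [σ.app_mu_assoc, τ.app_mu, ← tensorHom_comp_tensorHom, Category.assoc],
    fun A => by rw [σ.app_eps_assoc, τ.app_eps],
    fun A => by rw [σ.app_one_assoc, τ.app_one]⟩
  id_comp σ := Hom.ext (by ext; exact Category.id_comp _)
  comp_id σ := Hom.ext (by ext; exact Category.comp_id _)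
  assoc σ τ ρ := Hom.ext (by ext; exact Category.assoc _ _ _)

end UPrecat

namespace UPrecat

variable {M} {X Y : Type w}

/-- The pullback `f^* F` of a unital precategory. -/
abbrev pullback (f : X → Y) (F : UPrecat M Y) : UPrecat M X where
  toPrecat := F.toPrecat.pullback f
  one A := F.one (f A) ≫ F.res (eqToHom (Chain.map_edge f A A).symm)
  one_left {A B} s σ := by
    have e : Chain.map f ((Chain.edge A A).concat s) =
        (Chain.edge (f A) (f A)).concat (s.map f) := by
      rw [Chain.map_concat, Chain.map_edge]
    have h := F.one_left (s.map f) (Chain.mapHom f σ ≫ eqToHom e) =≫ F.res (eqToHom e.symm)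
    simp only [Category.assoc, ← F.res_comp, eqToHom_trans, eqToHom_refl, Category.comp_id] at h
    simp only [comp_whiskerRight, Category.assoc, ← F.mu_left_assoc, ← F.res_comp]
    rw [h]
    congr 3
    refine Chain.hom_ext fun i => ?_
    simp only [Chain.ap_comp, Chain.Coll.ap_concat, Chain.ap_eqToHom, Chain.ap_id']
    grind
  one_right {A B} s σ := by
    have e : Chain.map f (s.concat (Chain.edge B B)) =
        (s.map f).concat (Chain.edge (f B) (f B)) := by
      rw [Chain.map_concat, Chain.map_edge]
    have h := F.one_right (s.map f) (Chain.mapHom f σ ≫ eqToHom e) =≫ F.res (eqToHom e.symm)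
    simp only [Category.assoc, ← F.res_comp, eqToHom_trans, eqToHom_refl, Category.comp_id] at h
    simp only [MonoidalCategory.whiskerLeft_comp, Category.assoc, ← F.mu_right_assoc,
      ← F.res_comp]
    rw [h]
    congr 3
    refine Chain.hom_ext fun i => ?_
    simp only [Chain.ap_comp, Chain.Coll.ap_concat, Chain.ap_eqToHom, Chain.ap_id']
    grind

end UPrecat

/-- An object of the category of unital precategories over all sets: a set `X` with a unital
precategory on it. -/
structure CoSeg where
  X : Type w
  F : UPrecat M X

namespace CoSeg

variable {M}

/-- A morphism `(f, σ)`: a function `f : X → Y` and a morphism of unital precategories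
`σ : F ⟶ f^* G`. -/
structure Hom (P Q : CoSeg.{w} M) where
  fn : P.X → Q.X
  nat : P.F ⟶ Q.F.pullback fn


instance : Category (CoSeg.{w} M) where
  Hom := Hom
  id P := ⟨fun A => A,
    { app := fun s => 𝟙 (P.F.val s)
      naturality := fun σ => (Category.comp_id _).trans (Category.id_comp _).symm
      app_mu := fun s t => by
        rw [id_tensorHom_id, Category.id_comp, Category.comp_id]
        exact ((congrArg (P.F.mu s t ≫ ·) (P.F.res_id _)).trans (Category.comp_id _)).symm
      app_eps := fun A => Category.comp_id _
      app_one := fun A => by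
        rw [Category.comp_id]
        exact ((congrArg (P.F.one A ≫ ·) (P.F.res_id _)).trans (Category.comp_id _)).symm }⟩
  comp {P Q R} σ τ := ⟨fun A => τ.fn (σ.fn A),
    { app := fun s => σ.nat.app s ≫ τ.nat.app (s.map σ.fn)
      naturality := fun ρ => by
        rw [σ.nat.naturality_assoc, τ.nat.naturality, Category.assoc]
        rfl
      app_mu := fun s t => by
        rw [σ.nat.app_mu_assoc, Category.assoc, τ.nat.naturality, τ.nat.app_mu_assoc,
          ← tensorHom_comp_tensorHom, Category.assoc, Category.assoc, ← R.F.res_comp]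
        congr 4
        refine Chain.hom_ext fun i => ?_
        simp only [Chain.ap_comp, Chain.ap_eqToHom, Chain.ap_mapHom]
      app_eps := fun A => by
        rw [σ.nat.app_eps_assoc]
        exact τ.nat.app_eps _
      app_one := fun A => by
        rw [σ.nat.app_one_assoc, Category.assoc, τ.nat.naturality, τ.nat.app_one_assoc,
          Category.assoc, ← R.F.res_comp]
        congr 2
        refine Chain.hom_ext fun i => ?_
        simp only [Chain.ap_comp, Chain.ap_eqToHom, Chain.ap_mapHom] }⟩
  id_comp σ := congrArg (Hom.mk _) (UPrecat.Hom.ext (by ext; exact Category.id_comp _))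
  comp_id σ := congrArg (Hom.mk _) (UPrecat.Hom.ext (by ext; exact Category.comp_id _))
  assoc σ τ ρ := congrArg (Hom.mk _) (UPrecat.Hom.ext (by ext; exact Category.assoc _ _ _))

end CoSeg


section Tensor

variable {M} [SymmetricCategory M]

/-- The levelwise tensor product of two precategories on the same set. -/
abbrev Precat.tensor {X : Type w} (F G : Precat M X) : Precat M X where
  val s := F.val s ⊗ G.val s
  res σ := F.res σ ⊗ₘ G.res σ
  res_id s := by simp
  res_comp σ τ := by simp only [Precat.res_comp, tensorHom_comp_tensorHom]
  mu s t := tensorμ (F.val s) (G.val s) (F.val t) (G.val t) ≫ (F.mu s t ⊗ₘ G.mu s t)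
  mu_natural σ τ := by
    rw [Category.assoc, tensorHom_comp_tensorHom, F.mu_natural, G.mu_natural,
      ← tensorHom_comp_tensorHom, tensorμ_natural_assoc]
  mu_assoc r s t := by
    have h := tensor_associativity (F.val r) (G.val r) (F.val s) (G.val s) (F.val t) (G.val t)
    simp only [comp_whiskerRight, MonoidalCategory.whiskerLeft_comp, Category.assoc,
      tensorHom_comp_tensorHom]
    rw [tensorμ_natural_left_assoc, tensorμ_natural_right_assoc]
    simp only [tensorHom_comp_tensorHom, F.mu_assoc, G.mu_assoc]
    rw [← tensorHom_comp_tensorHom, reassoc_of% h]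
  eps A := (λ_ (𝟙_ M)).inv ≫ (F.eps A ⊗ₘ G.eps A)
  eps_left s := by
    have h := tensor_left_unitality (F.val s) (G.val s)
    simp only [F.eps_left, G.eps_left, comp_whiskerRight, Category.assoc]
    rw [tensorμ_natural_left_assoc, tensorHom_comp_tensorHom, Iso.eq_inv_comp, h]
    simp only [Category.assoc, tensorHom_comp_tensorHom, Iso.hom_inv_id_assoc]
  eps_right s := by
    have h := tensor_right_unitality (F.val s) (G.val s)
    simp only [F.eps_right, G.eps_right, MonoidalCategory.whiskerLeft_comp, Category.assoc]
    rw [tensorμ_natural_right_assoc, tensorHom_comp_tensorHom, Iso.eq_inv_comp, h]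
    simp only [Category.assoc, tensorHom_comp_tensorHom, Iso.hom_inv_id_assoc]
  eps_iso A := inferInstance

/-- The levelwise tensor product of two unital precategories on the same set. -/
abbrev UPrecat.tensor {X : Type w} (F G : UPrecat M X) : UPrecat M X where
  toPrecat := F.toPrecat.tensor G.toPrecat
  one A := (λ_ (𝟙_ M)).inv ≫ (F.one A ⊗ₘ G.one A)
  one_left s σ := by
    have h := tensor_left_unitality (F.val s) (G.val s)
    simp only [comp_whiskerRight, Category.assoc]
    rw [tensorμ_natural_left_assoc, h]
    simp only [Category.assoc, tensorHom_comp_tensorHom, F.one_left, G.one_left]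
  one_right s σ := by
    have h := tensor_right_unitality (F.val s) (G.val s)
    simp only [MonoidalCategory.whiskerLeft_comp, Category.assoc]
    rw [tensorμ_natural_right_assoc, h]
    simp only [Category.assoc, tensorHom_comp_tensorHom, F.one_right, G.one_right]

namespace CoSeg

/-- The tensor product `F ⊗_S G`, with objects `X × Y`. A chain in `X × Y` is a pair of chains `s`
in `X` and `s'` in `Y` of equal length, and `(F ⊗_S G)(s, s') = F(s) ⊗ G(s')`. -/
abbrev tensorObj (P Q : CoSeg.{w} M) : CoSeg.{w} M where
  X := P.X × Q.X
  F := (P.F.pullback Prod.fst).tensor (Q.F.pullback Prod.snd)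

/-- The tensor product of morphisms: `f × g` on objects, `σ_s ⊗ τ_{s'}` on `(s, s')`. -/
abbrev tensorMap {P P' Q Q' : CoSeg.{w} M} (σ : P ⟶ P') (τ : Q ⟶ Q') :
    tensorObj P Q ⟶ tensorObj P' Q' where
  fn := Prod.map σ.fn τ.fn
  nat :=
    { app := fun s => σ.nat.app (s.map Prod.fst) ⊗ₘ τ.nat.app (s.map Prod.snd)
      naturality := fun ρ =>
        (tensorHom_comp_tensorHom _ _ _ _).trans ((congrArg₂ _
          (σ.nat.naturality (Chain.mapHom Prod.fst ρ))
          (τ.nat.naturality (Chain.mapHom Prod.snd ρ))).trans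
          (tensorHom_comp_tensorHom _ _ _ _).symm)
      app_mu := fun s t => by
        rw [Category.assoc, tensorHom_comp_tensorHom, Category.assoc, Category.assoc,
          σ.nat.naturality, τ.nat.naturality, σ.nat.app_mu_assoc, τ.nat.app_mu_assoc,
          Category.assoc, Category.assoc, ← tensorHom_comp_tensorHom, ← tensorμ_natural_assoc,
          ← P'.F.res_comp, ← Q'.F.res_comp]
        simp only [Category.assoc, tensorHom_comp_tensorHom, ← P'.F.res_comp, ← Q'.F.res_comp,
          Chain.mapHom_eqToHom, eqToHom_trans]
        rfl
      app_eps := fun A => by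
        simp only [Category.assoc, tensorHom_comp_tensorHom, σ.nat.app_eps, τ.nat.app_eps]
        rfl
      app_one := fun A => by
        rw [Category.assoc, tensorHom_comp_tensorHom, Category.assoc, Category.assoc,
          σ.nat.naturality, τ.nat.naturality, σ.nat.app_one_assoc, τ.nat.app_one_assoc,
          Category.assoc, Category.assoc, ← P'.F.res_comp, ← Q'.F.res_comp]
        simp only [Category.assoc, tensorHom_comp_tensorHom, ← P'.F.res_comp, ← Q'.F.res_comp,
          Chain.mapHom_eqToHom, eqToHom_trans]
        rfl }

/-- The precategory `Un`: one object, constant with value the unit `I` of `M`. -/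
def unit : CoSeg.{w} M where
  X := PUnit
  F :=
    { val := fun _ => 𝟙_ M
      res := fun _ => 𝟙 _
      res_id := fun _ => rfl
      res_comp := fun _ _ => (Category.comp_id _).symm
      mu := fun _ _ => (λ_ (𝟙_ M)).hom
      mu_natural := fun _ _ => by simp
      mu_assoc := fun _ _ _ => by simp; monoidal
      eps := fun _ => 𝟙 _
      eps_left := fun _ => by simp
      eps_right := fun _ => by simp [unitors_equal]
      eps_iso := fun _ => inferInstance
      one := fun _ => 𝟙 _
      one_left := fun _ _ => by simp
      one_right := fun _ _ => by simp [unitors_equal] }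

end CoSeg

end Tensor


/-- A small (strict) `M`-enriched category. -/
structure EnrCat where
  X : Type w
  [enr : EnrichedCategory M X]

namespace EnrCat

variable {M}

attribute [instance] enr

/-- The category of small `M`-categories and `M`-functors. -/
instance : Category (EnrCat.{w} M) where
  Hom C D := EnrichedFunctor M C.X D.X
  id C := EnrichedFunctor.id M C.X
  comp F G := F.comp M G
  id_comp F := EnrichedFunctor.ext M (fun _ => rfl) (fun _ _ => by
    simp [EnrichedFunctor.comp, EnrichedFunctor.id])
  comp_id F := EnrichedFunctor.ext M (fun _ => rfl) (fun _ _ => by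
    simp [EnrichedFunctor.comp, EnrichedFunctor.id])
  assoc F G H := EnrichedFunctor.ext M (fun _ => rfl) (fun _ _ => by
    simp [EnrichedFunctor.comp])

/-- The unit `M`-category: one object with endomorphisms `I`. -/
def unit : EnrCat.{w} M where
  X := PUnit
  enr :=
    { Hom := fun _ _ => 𝟙_ M
      id := fun _ => 𝟙 _
      comp := fun _ _ _ => (λ_ (𝟙_ M)).hom
      id_comp := fun _ _ => by simp
      comp_id := fun _ _ => by simp [unitors_equal]
      assoc := fun _ _ _ _ => by simp; monoidal }

section

variable [SymmetricCategory M]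

/-- The hom-objects of `C ⊠ D` are `C(A, B) ⊗ D(A', B')`. -/
instance prodEnriched (X Y : Type w) [EnrichedCategory M X] [EnrichedCategory M Y] :
    EnrichedCategory M (X × Y) where
  Hom A B := (A.1 ⟶[M] B.1) ⊗ (A.2 ⟶[M] B.2)
  id A := (λ_ (𝟙_ M)).inv ≫ (eId M A.1 ⊗ₘ eId M A.2)
  comp A B E := tensorμ _ _ _ _ ≫ (eComp M A.1 B.1 E.1 ⊗ₘ eComp M A.2 B.2 E.2)
  id_comp A B := by
    have h := tensor_left_unitality (A.1 ⟶[M] B.1) (A.2 ⟶[M] B.2)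
    rw [Iso.inv_comp_eq, Category.comp_id, h, comp_whiskerRight, Category.assoc,
      tensorμ_natural_left_assoc, tensorHom_comp_tensorHom]
    have h1 := (Iso.inv_comp_eq _).1 (e_id_comp M A.1 B.1)
    have h2 := (Iso.inv_comp_eq _).1 (e_id_comp M A.2 B.2)
    rw [h1, h2, Category.comp_id, Category.comp_id]
  comp_id A B := by
    have h := tensor_right_unitality (A.1 ⟶[M] B.1) (A.2 ⟶[M] B.2)
    rw [Iso.inv_comp_eq, Category.comp_id, h, MonoidalCategory.whiskerLeft_comp,
      Category.assoc, tensorμ_natural_right_assoc, tensorHom_comp_tensorHom]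
    have h1 := (Iso.inv_comp_eq _).1 (e_comp_id M A.1 B.1)
    have h2 := (Iso.inv_comp_eq _).1 (e_comp_id M A.2 B.2)
    rw [h1, h2, Category.comp_id, Category.comp_id]
  assoc A B E G := by
    have h := tensor_associativity (A.1 ⟶[M] B.1) (A.2 ⟶[M] B.2) (B.1 ⟶[M] E.1)
      (B.2 ⟶[M] E.2) (E.1 ⟶[M] G.1) (E.2 ⟶[M] G.2)
    have h1 := (Iso.inv_comp_eq _).1 (e_assoc M A.1 B.1 E.1 G.1)
    have h2 := (Iso.inv_comp_eq _).1 (e_assoc M A.2 B.2 E.2 G.2)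
    rw [Iso.inv_comp_eq, comp_whiskerRight, MonoidalCategory.whiskerLeft_comp, Category.assoc,
      Category.assoc, tensorμ_natural_left_assoc, tensorμ_natural_right_assoc,
      tensorHom_comp_tensorHom, tensorHom_comp_tensorHom, h1, h2, ← tensorHom_comp_tensorHom,
      reassoc_of% h]

/-- The tensor product `C ⊠ D` of `M`-categories. -/
abbrev tensorObj (C D : EnrCat.{w} M) : EnrCat.{w} M where
  X := C.X × D.X

/-- The tensor product of `M`-functors. -/
abbrev tensorMap {C C' D D' : EnrCat.{w} M} (F : C ⟶ C') (G : D ⟶ D') :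
    tensorObj C D ⟶ tensorObj C' D' where
  obj := Prod.map F.obj G.obj
  map A B := F.map A.1 B.1 ⊗ₘ G.map A.2 B.2
  map_id A := by
    change (_ ≫ (_ ⊗ₘ _)) ≫ (_ ⊗ₘ _) = _ ≫ (_ ⊗ₘ _)
    rw [Category.assoc, tensorHom_comp_tensorHom, F.map_id, G.map_id]
    rfl
  map_comp A B E := by
    change (_ ≫ (_ ⊗ₘ _)) ≫ (_ ⊗ₘ _) = _ ≫ _ ≫ (_ ⊗ₘ _)
    rw [Category.assoc, tensorHom_comp_tensorHom, F.map_comp, G.map_comp,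
      ← tensorHom_comp_tensorHom, tensorμ_natural_assoc]
    rfl

end

end EnrCat

section Inclusion

variable {M}

/-- The value on chains of length `n` of a normal precategory with constant value `H` on the chains of
positive length. -/
abbrev constVal (n : ℕ) (H : M) : M :=
  match n with
  | 0 => 𝟙_ M
  | _ + 1 => H

/-- The levelwise map induced by a map of values. -/
abbrev constMap (n : ℕ) {H K : M} (f : H ⟶ K) : constVal n H ⟶ constVal n K :=
  match n with
  | 0 => 𝟙 (𝟙_ M)
  | _ + 1 => f

/-- The canonical isomorphism from the tensor product of levelwise constant values. -/
abbrev constMu (n : ℕ) (H K : M) : constVal n H ⊗ constVal n K ⟶ constVal n (H ⊗ K) :=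
  match n with
  | 0 => (λ_ (𝟙_ M)).hom
  | _ + 1 => 𝟙 (H ⊗ K)

/-- The canonical isomorphism `I ≅ constVal n I`. -/
abbrev constEps (n : ℕ) : 𝟙_ M ⟶ constVal n (𝟙_ M) :=
  match n with
  | 0 => 𝟙 (𝟙_ M)
  | _ + 1 => 𝟙 (𝟙_ M)

theorem Chain.len_eq_zero_iff {X : Type w} {A B : X} {s t : Chain A B} (σ : s ⟶ t) :
    s.len = 0 ↔ t.len = 0 := by
  constructor
  · intro h
    by_contra h'
    have := (Chain.Coll.toFun σ ⟨0, Nat.pos_of_ne_zero h'⟩).2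
    omega
  · intro h
    by_contra h'
    obtain ⟨i, -⟩ := Chain.Coll.surj σ ⟨0, Nat.pos_of_ne_zero h'⟩
    have := i.2
    omega

theorem Chain.eq_of_len {X : Type w} {A B : X} (s : Chain A B) (h : s.len = 0) : A = B :=
  s.src.symm.trans (s.tgt 0 (by omega))

theorem constVal_congr {n m : ℕ} (h : n = 0 ↔ m = 0) (H : M) : constVal n H = constVal m H := by
  cases n <;> cases m <;> simp_all

/-- The laxity maps of the precategory of an `M`-category: composition on chains of positive length, unit
isomorphisms otherwise. -/
abbrev iotaMu {X : Type w} [EnrichedCategory M X] (A B C : X) (n m : ℕ) (hn : n = 0 → A = B)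
    (hm : m = 0 → B = C) :
    constVal n (A ⟶[M] B) ⊗ constVal m (B ⟶[M] C) ⟶ constVal (n + m) (A ⟶[M] C) :=
  match n, m with
  | 0, 0 => (λ_ (𝟙_ M)).hom
  | 0, m + 1 => (λ_ (B ⟶[M] C)).hom ≫ eqToHom (by rw [hn rfl])
  | n + 1, 0 => (ρ_ (A ⟶[M] B)).hom ≫ eqToHom (by rw [hm rfl])
  | n + 1, m + 1 => eComp M A B C

theorem iotaMu_natural {X : Type w} [EnrichedCategory M X] (A B C : X) (n m n' m' : ℕ)
    (hn : n = 0 → A = B) (hm : m = 0 → B = C) (h : n = 0 ↔ n' = 0) (h' : m = 0 ↔ m' = 0) :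
    iotaMu (M := M) A B C n m hn hm ≫ eqToHom (constVal_congr (by omega) _) =
      (eqToHom (constVal_congr h _) ⊗ₘ eqToHom (constVal_congr h' _)) ≫
        iotaMu A B C n' m' (fun e => hn (h.2 e)) (fun e => hm (h'.2 e)) := by
  rcases n with _ | n <;> rcases n' with _ | n' <;> first | omega | skip
  all_goals rcases m with _ | m <;> rcases m' with _ | m' <;> first | omega | skip
  all_goals simp [iotaMu]

theorem iotaMu_assoc {X : Type w} [EnrichedCategory M X] (A B C D : X) (n m k : ℕ)
    (hn : n = 0 → A = B) (hm : m = 0 → B = C) (hk : k = 0 → C = D) :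
    iotaMu (M := M) A B C n m hn hm ▷ constVal k (C ⟶[M] D) ≫
        iotaMu A C D (n + m) k (fun e => (hn (by omega)).trans (hm (by omega))) hk ≫
          eqToHom (constVal_congr (by omega) _) =
      (α_ _ _ _).hom ≫ constVal n (A ⟶[M] B) ◁ iotaMu B C D m k hm hk ≫
        iotaMu A B D n (m + k) hn (fun e => (hm (by omega)).trans (hk (by omega))) := by
  rcases n with _ | n
  · obtain rfl := hn rfl
    rcases m with _ | m
    · obtain rfl := hm rfl
      rcases k with _ | k
      · obtain rfl := hk rfl
        simp only [iotaMu, constVal, eqToHom_refl, Category.comp_id]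
        monoidal
      · simp [iotaMu]
    · rcases k with _ | k
      · obtain rfl := hk rfl
        simp [iotaMu]
      · simp [iotaMu]
  · rcases m with _ | m
    · obtain rfl := hm rfl
      rcases k with _ | k
      · obtain rfl := hk rfl
        simp [iotaMu]
      · simp [iotaMu]
    · rcases k with _ | k
      · obtain rfl := hk rfl
        simp [iotaMu]
      · have := (Iso.inv_comp_eq _).1 (e_assoc M A B C D)
        simp [iotaMu, this]

theorem iotaMu_unit_left {X : Type w} [EnrichedCategory M X] (A B : X) (n : ℕ)
    (hn : n = 0 → A = B) :
    eqToHom (constVal_congr (by omega) _) =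
      (λ_ (constVal n (A ⟶[M] B))).inv ≫ 𝟙 (𝟙_ M) ▷ constVal n (A ⟶[M] B) ≫
        iotaMu (M := M) A A B 0 n (fun _ => rfl) hn := by
  rcases n with _ | n
  · simp [iotaMu]
  · simp [iotaMu]

theorem iotaMu_unit_right {X : Type w} [EnrichedCategory M X] (A B : X) (n : ℕ)
    (hn : n = 0 → A = B) :
    eqToHom (constVal_congr (by omega) _) =
      (ρ_ (constVal n (A ⟶[M] B))).inv ≫ constVal n (A ⟶[M] B) ◁ 𝟙 (𝟙_ M) ≫
        iotaMu (M := M) A B B n 0 hn (fun _ => rfl) := by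
  rcases n with _ | n
  · simp [iotaMu, unitors_equal]
  · simp [iotaMu]

/-- An `M`-category `C` as a unital precategory: the value on a chain of positive length from `A` to
`B` is `C(A, B)`, all 2-morphisms act as identities, the laxity maps are the compositions, and the
units are the identities of `C`. -/
def iotaObj (C : EnrCat.{w} M) : CoSeg.{w} M where
  X := C.X
  F :=
    { val := fun {A B} s => constVal s.len (A ⟶[M] B)
      res := fun σ => eqToHom (constVal_congr (Chain.len_eq_zero_iff σ) _)
      res_id := fun _ => rfl
      res_comp := fun _ _ => (eqToHom_trans _ _).symm
      mu := fun {A B C} s t => iotaMu A B C s.len t.len s.eq_of_len t.eq_of_len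
      mu_natural := fun {A B C} s s' t t' σ τ =>
        iotaMu_natural A B C s.len t.len s'.len t'.len s.eq_of_len t.eq_of_len
          (Chain.len_eq_zero_iff σ) (Chain.len_eq_zero_iff τ)
      mu_assoc := fun {A B C D} r s t =>
        iotaMu_assoc A B C D r.len s.len t.len r.eq_of_len s.eq_of_len t.eq_of_len
      eps := fun _ => 𝟙 _
      eps_left := fun {A B} s => iotaMu_unit_left A B s.len s.eq_of_len
      eps_right := fun {A B} s => iotaMu_unit_right A B s.len s.eq_of_len
      eps_iso := fun _ => inferInstanceAs (IsIso (𝟙 (𝟙_ M)))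
      one := fun A => eId M A
      one_left := fun {A B} s σ => by
        obtain ⟨n, x, h0, hn⟩ := s
        rcases n with _ | n
        · have := (Chain.Coll.toFun σ ⟨0, Nat.succ_pos _⟩).2
          exact absurd this (Nat.not_lt_zero _)
        · have h1 := (Iso.inv_comp_eq _).1 (e_id_comp M A B)
          simpa using h1.symm
      one_right := fun {A B} s σ => by
        obtain ⟨n, x, h0, hn⟩ := s
        rcases n with _ | n
        · have := (Chain.Coll.toFun σ ⟨0, Nat.succ_pos _⟩).2
          exact absurd this (Nat.not_lt_zero _)
        · have h1 := (Iso.inv_comp_eq _).1 (e_comp_id M A B)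
          simpa using h1.symm }

theorem iotaMu_map {X Y : Type w} [EnrichedCategory M X] [EnrichedCategory M Y]
    (F : EnrichedFunctor M X Y) (A B C : X) (n m : ℕ) (hn : n = 0 → A = B) (hm : m = 0 → B = C) :
    iotaMu A B C n m hn hm ≫ constMap (n + m) (F.map A C) =
      (constMap n (F.map A B) ⊗ₘ constMap m (F.map B C)) ≫
        iotaMu (F.obj A) (F.obj B) (F.obj C) n m (fun e => congrArg F.obj (hn e))
          (fun e => congrArg F.obj (hm e)) := by
  rcases n with _ | n
  · obtain rfl := hn rfl
    rcases m with _ | m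
    · obtain rfl := hm rfl
      simp [iotaMu, constMap]
    · simp [iotaMu, constMap]
  · rcases m with _ | m
    · obtain rfl := hm rfl
      simp [iotaMu, constMap]
    · simp [iotaMu, constMap]

theorem constMap_natural {n m : ℕ} (h : n = 0 ↔ m = 0) {H K : M} (f : H ⟶ K) :
    eqToHom (constVal_congr h H) ≫ constMap m f = constMap n f ≫ eqToHom (constVal_congr h K) := by
  rcases n with _ | n <;> rcases m with _ | m <;> first | omega | simp [constMap]

/-- The morphism of precategories given by an `M`-functor. -/
def iotaMap {C D : EnrCat.{w} M} (F : C ⟶ D) : iotaObj C ⟶ iotaObj D where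
  fn := F.obj
  nat :=
    { app := fun {A B} s => constMap s.len (F.map A B)
      naturality := fun σ => constMap_natural (Chain.len_eq_zero_iff σ) _
      app_mu := fun {A B E} s t =>
        (iotaMu_map F A B E s.len t.len s.eq_of_len t.eq_of_len).trans
          (congrArg (_ ≫ ·) (Category.comp_id _).symm)
      app_eps := fun _ => Category.comp_id _
      app_one := fun A => (F.map_id A).trans (Category.comp_id _).symm }

/-- The inclusion of strict `M`-categories into unital precategories. -/
def iota : EnrCat.{w} M ⥤ CoSeg.{w} M where
  obj := iotaObj
  map := iotaMap
  map_id C := congrArg (CoSeg.Hom.mk _) (UPrecat.Hom.ext (by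
    funext A B s
    obtain ⟨n, x, h0, hn⟩ := s
    cases n <;> rfl))
  map_comp F G := congrArg (CoSeg.Hom.mk _) (UPrecat.Hom.ext (by
    funext A B s
    obtain ⟨n, x, h0, hn⟩ := s
    cases n
    · exact (Category.comp_id _).symm
    · rfl))

end Inclusion

section Structures

/-- The given tensor product, unit and coherence isomorphisms satisfy the axioms of a monoidal category. -/
def IsMonoidal {C : Type u} [Category.{v} C] (S : MonoidalCategoryStruct C) : Prop :=
  ∃ T : MonoidalCategory C, T.toMonoidalCategoryStruct = S

/-- The resulting monoidal category; its underlying data are exactly the given ones. -/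
abbrev IsMonoidal.monoidal {C : Type u} [Category.{v} C] {S : MonoidalCategoryStruct C}
    (h : IsMonoidal S) : MonoidalCategory C :=
  { S with
    tensorHom_def := by obtain ⟨T, rfl⟩ := h; exact T.tensorHom_def
    id_tensorHom_id := by obtain ⟨T, rfl⟩ := h; exact T.id_tensorHom_id
    tensorHom_comp_tensorHom := by obtain ⟨T, rfl⟩ := h; exact T.tensorHom_comp_tensorHom
    whiskerLeft_id := by obtain ⟨T, rfl⟩ := h; exact T.whiskerLeft_id
    id_whiskerRight := by obtain ⟨T, rfl⟩ := h; exact T.id_whiskerRight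
    associator_naturality := by obtain ⟨T, rfl⟩ := h; exact T.associator_naturality
    leftUnitor_naturality := by obtain ⟨T, rfl⟩ := h; exact T.leftUnitor_naturality
    rightUnitor_naturality := by obtain ⟨T, rfl⟩ := h; exact T.rightUnitor_naturality
    pentagon := by obtain ⟨T, rfl⟩ := h; exact T.pentagon
    triangle := by obtain ⟨T, rfl⟩ := h; exact T.triangle }

variable {M}

/-- The morphism `σ` is the pair of the function `f` and the family of maps `c` on chains. -/
def CoSeg.Hom.Is {P Q : CoSeg.{w} M} (σ : P ⟶ Q) (f : P.X → Q.X)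
    (c : ∀ {A B : P.X} (s : Chain A B), P.F.val s ⟶ Q.F.val (s.map f)) : Prop :=
  ∃ τ : P.F ⟶ Q.F.pullback f, σ = ⟨f, τ⟩ ∧ ∀ {A B : P.X} (s : Chain A B), τ.app s = c s

/-- The `M`-functor `F` is given by `f` on objects and `c` on hom-objects. -/
def EnrCat.HomIs {C D : EnrCat.{w} M} (F : C ⟶ D) (f : C.X → D.X)
    (c : ∀ A B : C.X, (A ⟶[M] B) ⟶ (f A ⟶[M] f B)) : Prop :=
  ∃ h₁ h₂, F = ⟨f, c, h₁, h₂⟩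

variable [SymmetricCategory M]

/-- The data `(⊗_S, Un)` with given associators and unitors. -/
abbrev CoSeg.tensorStruct
    (a : ∀ P Q R : CoSeg.{w} M, tensorObj (tensorObj P Q) R ≅ tensorObj P (tensorObj Q R))
    (l : ∀ P : CoSeg.{w} M, tensorObj unit P ≅ P) (r : ∀ P : CoSeg.{w} M, tensorObj P unit ≅ P) :
    MonoidalCategoryStruct (CoSeg.{w} M) where
  tensorObj := tensorObj
  whiskerLeft P _ _ σ := tensorMap (𝟙 P) σ
  whiskerRight σ P := tensorMap σ (𝟙 P)
  tensorHom := tensorMap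
  tensorUnit := unit
  associator := a
  leftUnitor := l
  rightUnitor := r

/-- The data `(⊠, unit)` on `M`-categories with given associators and unitors. -/
abbrev EnrCat.tensorStruct
    (a : ∀ C D E : EnrCat.{w} M, tensorObj (tensorObj C D) E ≅ tensorObj C (tensorObj D E))
    (l : ∀ C : EnrCat.{w} M, tensorObj unit C ≅ C) (r : ∀ C : EnrCat.{w} M, tensorObj C unit ≅ C) :
    MonoidalCategoryStruct (EnrCat.{w} M) where
  tensorObj := tensorObj
  whiskerLeft C _ _ F := tensorMap (𝟙 C) F
  whiskerRight F C := tensorMap F (𝟙 C)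
  tensorHom := tensorMap
  tensorUnit := unit
  associator := a
  leftUnitor := l
  rightUnitor := r

end Structures

end CoSegal

open CoSegal

/-! A chain is a length together with its vertices, and a collapse is determined by its map of
edges, which the degree functor retains. Two chains or two collapses with the same image in `S_1`
therefore pair uniquely, which is the fibre product statement.

For the tensor product, the category of unital precategories is treated as lying over sets. Two
morphisms agree when their functions agree and their components on every chain agree
(`CoSeg.hom_ext`). The functions here are canonical bijections of products, so they agree
definitionally, and each monoidal or symmetry axiom becomes the same axiom of `M` at the values on
one chain. What needs an argument is that the constraints of `M`, taken chain by chain, are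
morphisms, i.e. respect laxity maps and units. For laxity maps this says that the constraints are
monoidal transformations when `⊗` is made a monoidal functor by `tensorμ`; composing with arbitrary
laxity maps gives `tensorμ_assoc_lax`, `tensorμ_leftUnitor_lax`, `tensorμ_rightUnitor_lax` and
`tensorμ_braiding_lax`. Only the last needs the braiding to be a symmetry. The associators and
unitors are invertible by a lifting argument (`CoSeg.exists_lift`): a morphism bijective on objects
and invertible on every chain is an isomorphism.

An `M`-category has the same shape of data, with composition as laxity map, so the same lemmas make
`M`-categories monoidal. The value of `ι(C)` on a chain depends only on its endpoints and on whether
its length is zero. Every identity for the comparison maps then splits into finitely many cases: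
positive lengths reduce to the definition of `⊠`, and zero lengths to unit coherence in `M`. The
comparison maps are invertible in each case, so the lax structure is strong. -/

namespace CoSegal

/-! ### Chains in a product of sets. -/

/-- The projections exhibit `S_{X × Y}` as the fibre product of `S_X` and `S_Y` over `S_1`. -/
theorem SOp.isFibreProduct (X Y : Type w) : SOp.IsFibreProduct X Y where
  obj a b _ := ⟨⟨(a.pt, b.pt)⟩, ⟨rfl, rfl⟩, by rintro _ ⟨rfl, rfl⟩; rfl⟩
  deg_obj _ := rfl
  map c d s t h := by
    have hlen : Chain.len s = Chain.len t := congrArg Chain.len h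
    refine ⟨⟨Chain.len s, fun i => (Chain.vtx s i, Chain.vtx t i),
      Prod.ext (Chain.src s) (Chain.src t),
      fun i hi => Prod.ext (Chain.tgt s i hi) (Chain.tgt t i (hlen ▸ hi))⟩, ⟨rfl, ?_⟩, ?_⟩
    · exact Chain.ext hlen rfl
    · rintro z ⟨rfl, rfl⟩
      rfl
  deg_map _ := rfl
  map₂ z z' (σ : Chain.Coll (Chain.map Prod.fst z') (Chain.map Prod.fst z))
      (τ : Chain.Coll (Chain.map Prod.snd z') (Chain.map Prod.snd z)) h := by
    have hfun : σ.toFun = τ.toFun := congrArg Chain.Coll.toFun h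
    refine ⟨⟨σ.toFun, σ.mono, σ.surj, fun i hi => Prod.ext (σ.vtx_eq i hi) ?_⟩,
      ⟨rfl, Chain.Coll.ext hfun⟩, ?_⟩
    -- The paired collapse uses the edge map of `σ`; the vertex condition in `Y` is that of `τ`,
    -- transported along the equality of edge maps.
    · have h2 := τ.vtx_eq i
      rw [← hfun] at h2
      exact h2 hi
    · rintro ρ ⟨rfl, rfl⟩
      rfl
  deg_map₂ _ := rfl

/-! ### Morphisms of precategories over a fixed function, and a criterion for isomorphisms. -/

namespace CoSeg

variable {M : Type u} [Category.{v} M] [MonoidalCategory M]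

/-- The target of a component depends on the function on objects, hence `HEq`; once the functions
are definitionally equal, an ordinary equality in `M` suffices. -/
theorem hom_ext {P Q : CoSeg.{w} M} {σ τ : P ⟶ Q} (hf : σ.fn = τ.fn)
    (h : ∀ {A B : P.X} (s : Chain A B), HEq (σ.nat.app s) (τ.nat.app s)) : σ = τ := by
  obtain ⟨f, φ⟩ := σ
  obtain ⟨f', ψ⟩ := τ
  obtain rfl : f = f' := hf
  exact congrArg (CoSeg.Hom.mk f)
    (UPrecat.Hom.ext (funext fun _ => funext fun _ => funext fun s => eq_of_heq (h s)))

/-- A morphism which is invertible on all chains is cartesian over sets. -/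
theorem exists_lift {P Q R : CoSeg.{w} M} (σ : P ⟶ Q)
    (hσ : ∀ {A B : P.X} (s : Chain A B), IsIso (σ.nat.app s)) (τ : R ⟶ Q) (k : R.X → P.X)
    (hk : τ.fn = fun A => σ.fn (k A)) : ∃ ρ : R ⟶ P, ρ.fn = k ∧ ρ ≫ σ = τ := by
  obtain ⟨t, φ⟩ := τ
  obtain rfl : t = fun A => σ.fn (k A) := hk
  -- The lift is `φ` followed by the inverses of the components of `σ`. The `key` facts say that
  -- these inverses respect restriction, laxity maps and units.
  have key : ∀ {A B : R.X} {s t : Chain (k A) (k B)} (ρ : s ⟶ t),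
      inv (σ.nat.app s) ≫ P.F.res ρ =
        Q.F.res (Chain.mapHom σ.fn ρ) ≫ inv (σ.nat.app t) := by
    intro A B s t ρ
    rw [IsIso.inv_comp_eq, ← Category.assoc, IsIso.eq_comp_inv]
    exact σ.nat.naturality ρ
  -- Mapping a chain by `k` and then by `σ.fn` is definitionally mapping it by the composite; only
  -- the restrictions along `Chain.map_concat` differ, and these merge by `eqToHom_trans`.
  have key_mu : ∀ {A B C : R.X} (s : Chain A B) (t : Chain B C),
      Q.F.mu ((s.map k).map σ.fn) ((t.map k).map σ.fn) ≫
        Q.F.res (eqToHom (Chain.map_concat (fun A => σ.fn (k A)) s t).symm) ≫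
          inv (σ.nat.app ((s.concat t).map k)) =
      (inv (σ.nat.app (s.map k)) ⊗ₘ inv (σ.nat.app (t.map k))) ≫
        P.F.mu (s.map k) (t.map k) ≫ P.F.res (eqToHom (Chain.map_concat k s t).symm) := by
    intro A B C s t
    have h2 : inv (σ.nat.app (s.map k)) ⊗ₘ inv (σ.nat.app (t.map k)) =
      inv (σ.nat.app (s.map k) ⊗ₘ σ.nat.app (t.map k)) := by simp
    rw [h2, IsIso.eq_inv_comp, ← Category.assoc, ← Category.assoc, IsIso.comp_inv_eq,
      Category.assoc, Category.assoc, σ.nat.naturality, σ.nat.app_mu_assoc]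
    congr 1
    simp only [Category.assoc, ← Q.F.res_comp, Chain.mapHom_eqToHom, eqToHom_trans]
  have key_one : ∀ A : R.X, Q.F.one (σ.fn (k A)) ≫
      Q.F.res (eqToHom (Chain.map_edge (fun A => σ.fn (k A)) A A).symm) ≫
        inv (σ.nat.app ((Chain.edge A A).map k)) =
      P.F.one (k A) ≫ P.F.res (eqToHom (Chain.map_edge k A A).symm) := by
    intro A
    rw [← Category.assoc, IsIso.comp_inv_eq, Category.assoc, σ.nat.naturality,
      σ.nat.app_one_assoc]
    simp only [Category.assoc, ← Q.F.res_comp, Chain.mapHom_eqToHom, eqToHom_trans]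
  refine ⟨⟨k, ⟨fun s => φ.app s ≫ inv (σ.nat.app (s.map k)), ?_, ?_, ?_, ?_⟩⟩, rfl, ?_⟩
  · intro A B s t ρ
    rw [φ.naturality_assoc]
    exact (congrArg (φ.app s ≫ ·) (key (Chain.mapHom k ρ)).symm).trans
      (Category.assoc _ _ _).symm
  · intro A B C s t
    rw [φ.app_mu_assoc]
    refine (congrArg (_ ≫ ·) ((Category.assoc _ _ _).trans (key_mu s t))).trans ?_
    rw [← Category.assoc, tensorHom_comp_tensorHom]
  · intro A
    rw [φ.app_eps_assoc]
    exact (IsIso.comp_inv_eq _).2 (σ.nat.app_eps (k A)).symm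
  · intro A
    rw [φ.app_one_assoc]
    exact (Category.assoc _ _ _).trans (key_one A)
  · refine hom_ext rfl fun s => heq_of_eq ?_
    exact (Category.assoc _ _ _).trans
      ((congrArg (φ.app s ≫ ·) (IsIso.inv_hom_id _)).trans (Category.comp_id _))

/-- Chainwise invertibility cancels the components only; `σ.fn` need not be injective, so equality
of the functions is a separate hypothesis. -/
theorem cancel_of_fn_eq {P Q R : CoSeg.{w} M} (σ : P ⟶ Q)
    (hσ : ∀ {A B : P.X} (s : Chain A B), IsIso (σ.nat.app s)) {ρ ρ' : R ⟶ P}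
    (hf : ρ.fn = ρ'.fn) (h : ρ ≫ σ = ρ' ≫ σ) : ρ = ρ' := by
  obtain ⟨k, φ⟩ := ρ
  obtain ⟨k', ψ⟩ := ρ'
  obtain rfl : k = k' := hf
  refine hom_ext rfl fun s => heq_of_eq ?_
  have h1 := eq_of_heq (CoSeg.Hom.mk.inj h).2
  have h2 : φ.app s ≫ σ.nat.app (s.map k) = ψ.app s ≫ σ.nat.app (s.map k) :=
    congrArg (fun θ => UPrecat.Hom.app θ s) h1
  exact (cancel_mono _).1 h2

/-- Lifting the identity of `Q` through `σ` over `g` gives a right inverse; it is also a left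
inverse, since `σ` can be cancelled on the right over equal functions. -/
theorem isIso_of_bijective {P Q : CoSeg.{w} M} (σ : P ⟶ Q) (g : Q.X → P.X)
    (hgf : ∀ A, g (σ.fn A) = A) (hfg : ∀ A, σ.fn (g A) = A)
    (hσ : ∀ {A B : P.X} (s : Chain A B), IsIso (σ.nat.app s)) : IsIso σ := by
  obtain ⟨ρ, rfl, h⟩ := exists_lift σ hσ (𝟙 Q) g (funext fun A => (hfg A).symm)
  refine ⟨ρ, cancel_of_fn_eq σ hσ (funext hgf) ?_, h⟩
  rw [Category.assoc, h, Category.comp_id, Category.id_comp]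

end CoSeg

/-! ### The same criterion for enriched functors. -/

namespace EnrCat

variable {M : Type u} [Category.{v} M] [MonoidalCategory M]

theorem hom_ext {C D : EnrCat.{w} M} {F G : C ⟶ D} (hf : F.obj = G.obj)
    (h : ∀ A B : C.X, HEq (F.map A B) (G.map A B)) : F = G := by
  obtain ⟨f, φ, _, _⟩ := F
  obtain ⟨f', ψ, _, _⟩ := G
  obtain rfl : f = f' := hf
  obtain rfl : φ = ψ := funext fun A => funext fun B => eq_of_heq (h A B)
  rfl

/-- A fully faithful enriched functor is cartesian over sets: the inverses of its maps on
hom-objects preserve identities and composition because the maps themselves do. -/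
theorem exists_lift {C D E : EnrCat.{w} M} (F : C ⟶ D) (hF : ∀ A B : C.X, IsIso (F.map A B))
    (G : E ⟶ D) (k : E.X → C.X) (hk : G.obj = fun A => F.obj (k A)) :
    ∃ H : E ⟶ C, H.obj = k ∧ H ≫ F = G := by
  obtain ⟨t, φ, h1, h2⟩ := G
  obtain rfl : t = fun A => F.obj (k A) := hk
  refine ⟨⟨k, fun A B => φ A B ≫ inv (F.map (k A) (k B)), ?_, ?_⟩, rfl, ?_⟩
  · intro A
    rw [← Category.assoc, IsIso.comp_inv_eq, h1]
    exact (F.map_id (k A)).symm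
  · intro A B B'
    have h3 : inv (F.map (k A) (k B)) ⊗ₘ inv (F.map (k B) (k B')) =
      inv (F.map (k A) (k B) ⊗ₘ F.map (k B) (k B')) := by simp
    rw [← Category.assoc, h2, ← tensorHom_comp_tensorHom, Category.assoc, Category.assoc]
    congr 1
    rw [h3, IsIso.eq_inv_comp, ← Category.assoc, IsIso.comp_inv_eq]
    exact (F.map_comp _ _ _).symm
  · refine hom_ext rfl fun A B => heq_of_eq ?_
    exact (Category.assoc _ _ _).trans
      ((congrArg (φ A B ≫ ·) (IsIso.inv_hom_id _)).trans (Category.comp_id _))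

theorem cancel_of_obj_eq {C D E : EnrCat.{w} M} (F : C ⟶ D)
    (hF : ∀ A B : C.X, IsIso (F.map A B)) {H H' : E ⟶ C}
    (hf : H.obj = H'.obj) (h : H ≫ F = H' ≫ F) : H = H' := by
  obtain ⟨k, φ, a1, a2⟩ := H
  obtain ⟨k', ψ, b1, b2⟩ := H'
  obtain rfl : k = k' := hf
  refine hom_ext rfl fun A B => heq_of_eq ?_
  have h1 := eq_of_heq (EnrichedFunctor.mk.inj h).2
  have h2 : φ A B ≫ F.map (k A) (k B) = ψ A B ≫ F.map (k A) (k B) :=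
    congrFun (congrFun h1 A) B
  exact (cancel_mono _).1 h2

theorem isIso_of_bijective {C D : EnrCat.{w} M} (F : C ⟶ D) (g : D.X → C.X)
    (hgf : ∀ A, g (F.obj A) = A) (hfg : ∀ A, F.obj (g A) = A)
    (hF : ∀ A B : C.X, IsIso (F.map A B)) : IsIso F := by
  obtain ⟨ρ, rfl, h⟩ := exists_lift F hF (𝟙 D) g (funext fun A => (hfg A).symm)
  refine ⟨ρ, cancel_of_obj_eq F hF (funext hgf) ?_, h⟩
  rw [Category.assoc, h, Category.comp_id, Category.id_comp]

end EnrCat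

end CoSegal

/-! ### Compatibility of the constraints of `M` with units and laxity maps. -/

namespace CoSegal

variable {M : Type u} [Category.{v} M] [MonoidalCategory M]

theorem unit_tensor_assoc {P Q R : M} (p : 𝟙_ M ⟶ P) (q : 𝟙_ M ⟶ Q) (r : 𝟙_ M ⟶ R) :
    ((λ_ (𝟙_ M)).inv ≫ (((λ_ (𝟙_ M)).inv ≫ (p ⊗ₘ q)) ⊗ₘ r)) ≫ (α_ P Q R).hom =
      (λ_ (𝟙_ M)).inv ≫ (p ⊗ₘ ((λ_ (𝟙_ M)).inv ≫ (q ⊗ₘ r))) := by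
  have h1 : ((λ_ (𝟙_ M)).inv ≫ (p ⊗ₘ q)) ⊗ₘ r =
      (λ_ (𝟙_ M)).inv ▷ 𝟙_ M ≫ ((p ⊗ₘ q) ⊗ₘ r) := by
    rw [← tensorHom_id, tensorHom_comp_tensorHom, Category.id_comp]
  have h2 : p ⊗ₘ ((λ_ (𝟙_ M)).inv ≫ (q ⊗ₘ r)) =
      𝟙_ M ◁ (λ_ (𝟙_ M)).inv ≫ (p ⊗ₘ (q ⊗ₘ r)) := by
    rw [← id_tensorHom, tensorHom_comp_tensorHom, Category.id_comp]
  -- Naturality moves `p`, `q`, `r` to the end of both sides; what remains is an identity between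
  -- canonical maps of unit objects.
  rw [h1, h2, Category.assoc, Category.assoc, associator_naturality]
  simp only [← Category.assoc]
  congr 1
  monoidal

theorem unit_tensor_leftUnitor {P : M} (p : 𝟙_ M ⟶ P) :
    ((λ_ (𝟙_ M)).inv ≫ (𝟙 (𝟙_ M) ⊗ₘ p)) ≫ (λ_ P).hom = p := by
  simp

theorem unit_tensor_rightUnitor {P : M} (p : 𝟙_ M ⟶ P) :
    ((λ_ (𝟙_ M)).inv ≫ (p ⊗ₘ 𝟙 (𝟙_ M))) ≫ (ρ_ P).hom = p := by
  rw [tensorHom_id, Category.assoc, rightUnitor_naturality, ← unitors_equal, Iso.inv_hom_id_assoc]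

section Braided

variable [BraidedCategory M]

/-- This is monoidality of the associator, followed by `p ⊗ (q ⊗ r)`. The maps are arbitrary so that
it applies both to laxity maps and to enriched composition. -/
theorem tensorμ_assoc_lax {P Q R P' Q' R' P'' Q'' R'' : M} (p : P ⊗ P' ⟶ P'') (q : Q ⊗ Q' ⟶ Q'')
    (r : R ⊗ R' ⟶ R'') :
    tensorμ (P ⊗ Q) R (P' ⊗ Q') R' ≫ ((tensorμ P Q P' Q' ≫ (p ⊗ₘ q)) ⊗ₘ r) ≫ (α_ _ _ _).hom =
      ((α_ _ _ _).hom ⊗ₘ (α_ _ _ _).hom) ≫ tensorμ P (Q ⊗ R) P' (Q' ⊗ R') ≫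
        (p ⊗ₘ (tensorμ Q R Q' R' ≫ (q ⊗ₘ r))) := by
  have h := associator_monoidal P Q R P' Q' R' =≫ (p ⊗ₘ (q ⊗ₘ r))
  simp only [Category.assoc] at h
  rw [← associator_naturality, ← tensorHom_id, ← id_tensorHom] at h
  simpa only [tensorHom_comp_tensorHom, tensorHom_comp_tensorHom_assoc, Category.id_comp] using h

theorem tensorμ_leftUnitor_lax {P P' P'' : M} (p : P ⊗ P' ⟶ P'') :
    (tensorμ (𝟙_ M) P (𝟙_ M) P' ≫ ((λ_ (𝟙_ M)).hom ⊗ₘ p)) ≫ (λ_ P'').hom =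
      ((λ_ P).hom ⊗ₘ (λ_ P').hom) ≫ p := by
  rw [leftUnitor_monoidal, Category.assoc, Category.assoc, Category.assoc,
    MonoidalCategory.tensorHom_def, Category.assoc, leftUnitor_naturality]

theorem tensorμ_rightUnitor_lax {P P' P'' : M} (p : P ⊗ P' ⟶ P'') :
    (tensorμ P (𝟙_ M) P' (𝟙_ M) ≫ (p ⊗ₘ (λ_ (𝟙_ M)).hom)) ≫ (ρ_ P'').hom =
      ((ρ_ P).hom ⊗ₘ (ρ_ P').hom) ≫ p := by
  rw [rightUnitor_monoidal, Category.assoc, Category.assoc, Category.assoc,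
    MonoidalCategory.tensorHom_def', Category.assoc, rightUnitor_naturality]

/-- By naturality the braiding moves to `I ⊗ I`, where it turns the inverse left unitor into the
inverse right unitor, and these coincide at `I`. -/
theorem unit_tensor_braiding {P Q : M} (p : 𝟙_ M ⟶ P) (q : 𝟙_ M ⟶ Q) :
    ((λ_ (𝟙_ M)).inv ≫ (p ⊗ₘ q)) ≫ (β_ P Q).hom = (λ_ (𝟙_ M)).inv ≫ (q ⊗ₘ p) := by
  rw [Category.assoc, BraidedCategory.braiding_naturality, leftUnitor_inv_braiding_assoc,
    unitors_inv_equal]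

end Braided

variable [SymmetricCategory M]

/-- Expanding the braiding of the two products by the hexagons produces a crossing of `C` past `B`.
By symmetry it undoes the crossing of `B` past `C` in `tensorμ`; a mere braiding would not suffice.
-/
theorem tensorμ_braiding (A B C D : M) :
    tensorμ A B C D ≫ (β_ (A ⊗ C) (B ⊗ D)).hom =
      ((β_ A B).hom ⊗ₘ (β_ C D).hom) ≫ tensorμ B A D C := by
  simp [tensorμ, SymmetricCategory.braiding_swap_eq_inv_braiding C B,
    MonoidalCategory.tensorHom_def]

theorem tensorμ_braiding_lax {P Q P' Q' P'' Q'' : M} (p : P ⊗ P' ⟶ P'') (q : Q ⊗ Q' ⟶ Q'') :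
    (tensorμ P Q P' Q' ≫ (p ⊗ₘ q)) ≫ (β_ P'' Q'').hom =
      ((β_ P Q).hom ⊗ₘ (β_ P' Q').hom) ≫ tensorμ Q P Q' P' ≫ (q ⊗ₘ p) := by
  rw [Category.assoc, BraidedCategory.braiding_naturality, reassoc_of% tensorμ_braiding]

/-! ### The symmetric monoidal category of unital precategories. -/

namespace CoSeg

/-- The associativity constraint `(P ⊗_S Q) ⊗_S R ⟶ P ⊗_S (Q ⊗_S R)`. -/
def assocHom (P Q R : CoSeg.{w} M) :
    tensorObj (tensorObj P Q) R ⟶ tensorObj P (tensorObj Q R) where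
  fn A := (A.1.1, A.1.2, A.2)
  nat :=
    { app := fun s => (α_ (P.F.val (s.map fun A => A.1.1)) (Q.F.val (s.map fun A => A.1.2))
        (R.F.val (s.map fun A => A.2))).hom
      naturality := fun ρ => associator_naturality (P.F.res (Chain.mapHom (fun A => A.1.1) ρ))
        (Q.F.res (Chain.mapHom (fun A => A.1.2) ρ)) (R.F.res (Chain.mapHom (fun A => A.2) ρ))
      app_mu := fun s t => by
        have h := tensorμ_assoc_lax
          (P.F.mu (s.map fun A => A.1.1) (t.map fun A => A.1.1) ≫
            P.F.res (eqToHom (Chain.map_concat (fun A => A.1.1) s t).symm))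
          (Q.F.mu (s.map fun A => A.1.2) (t.map fun A => A.1.2) ≫
            Q.F.res (eqToHom (Chain.map_concat (fun A => A.1.2) s t).symm))
          (R.F.mu (s.map fun A => A.2) (t.map fun A => A.2) ≫
            R.F.res (eqToHom (Chain.map_concat (fun A => A.2) s t).symm))
        -- An iterated tensor product carries one transport for each nested pullback; they collapse
        -- to a single transport along the composite projection, as in `h`.
        simp only [Category.assoc, tensorHom_comp_tensorHom, ← Precat.res_comp,
          Chain.mapHom_eqToHom, eqToHom_trans]
        exact h
      app_eps := fun A => unit_tensor_assoc (P.F.eps A.1.1) (Q.F.eps A.1.2) (R.F.eps A.2)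
      app_one := fun A => by
        have h := unit_tensor_assoc
          (P.F.one A.1.1 ≫ P.F.res (eqToHom (Chain.map_edge (fun A => A.1.1) A A).symm))
          (Q.F.one A.1.2 ≫ Q.F.res (eqToHom (Chain.map_edge (fun A => A.1.2) A A).symm))
          (R.F.one A.2 ≫ R.F.res (eqToHom (Chain.map_edge (fun A => A.2) A A).symm))
        simp only [Category.assoc, tensorHom_comp_tensorHom, ← Precat.res_comp,
          Chain.mapHom_eqToHom, eqToHom_trans] at h ⊢
        exact h }

/-- The left unit constraint. -/
def leftUnitorHom (P : CoSeg.{w} M) : tensorObj unit P ⟶ P where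
  fn := Prod.snd
  nat :=
    { app := fun s => (λ_ (P.F.val (s.map Prod.snd))).hom
      naturality := fun ρ => (congrArg (· ≫ _) (id_tensorHom _ _)).trans
        (leftUnitor_naturality (P.F.res (Chain.mapHom Prod.snd ρ)))
      -- The laxity map of the pulled-back unit is the unitor followed by a restriction that is an
      -- identity, removed by `comp_id`.
      app_mu := fun _ _ =>
        (congrArg (fun f => (tensorμ _ _ _ _ ≫ (f ⊗ₘ _)) ≫ (λ_ _).hom)
          (Category.comp_id _)).trans (tensorμ_leftUnitor_lax _)
      app_eps := fun _ => unit_tensor_leftUnitor _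
      app_one := fun _ =>
        (congrArg (fun f => ((λ_ _).inv ≫ (f ⊗ₘ _)) ≫ (λ_ _).hom)
          (Category.comp_id _)).trans (unit_tensor_leftUnitor _) }

/-- The right unit constraint. -/
def rightUnitorHom (P : CoSeg.{w} M) : tensorObj P unit ⟶ P where
  fn := Prod.fst
  nat :=
    { app := fun s => (ρ_ (P.F.val (s.map Prod.fst))).hom
      naturality := fun ρ => (congrArg (· ≫ _) (tensorHom_id _ _)).trans
        (rightUnitor_naturality (P.F.res (Chain.mapHom Prod.fst ρ)))
      app_mu := fun _ _ =>
        (congrArg (fun f => (tensorμ _ _ _ _ ≫ (_ ⊗ₘ f)) ≫ (ρ_ _).hom)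
          (Category.comp_id _)).trans (tensorμ_rightUnitor_lax _)
      app_eps := fun _ => unit_tensor_rightUnitor _
      app_one := fun _ =>
        (congrArg (fun f => ((λ_ _).inv ≫ (_ ⊗ₘ f)) ≫ (ρ_ _).hom)
          (Category.comp_id _)).trans (unit_tensor_rightUnitor _) }

/-- The symmetry constraint. -/
def braidingHom (P Q : CoSeg.{w} M) : tensorObj P Q ⟶ tensorObj Q P where
  fn := Prod.swap
  nat :=
    { app := fun s => (β_ (P.F.val (s.map Prod.fst)) (Q.F.val (s.map Prod.snd))).hom
      naturality := fun ρ => BraidedCategory.braiding_naturality _ _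
      app_mu := fun s t => by
        simp only [Category.assoc, tensorHom_comp_tensorHom, ← Precat.res_comp,
          Chain.mapHom_eqToHom, eqToHom_trans]
        exact tensorμ_braiding_lax _ _
      app_eps := fun A => unit_tensor_braiding _ _
      app_one := fun A => by
        simp only [Category.assoc, tensorHom_comp_tensorHom, ← Precat.res_comp,
          Chain.mapHom_eqToHom, eqToHom_trans]
        refine (Category.assoc _ _ _).symm.trans ?_
        exact unit_tensor_braiding
          (P.F.one A.1 ≫ P.F.res (eqToHom (Chain.map_edge Prod.fst A A).symm))
          (Q.F.one A.2 ≫ Q.F.res (eqToHom (Chain.map_edge Prod.snd A A).symm)) }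

instance (P Q R : CoSeg.{w} M) : IsIso (assocHom P Q R) :=
  isIso_of_bijective _ (fun A => ((A.1, A.2.1), A.2.2)) (fun _ => rfl) (fun _ => rfl)
    fun _ => inferInstanceAs (IsIso (α_ _ _ _).hom)

instance (P : CoSeg.{w} M) : IsIso (leftUnitorHom P) :=
  isIso_of_bijective _ (fun A => (PUnit.unit, A)) (fun _ => rfl) (fun _ => rfl)
    fun _ => inferInstanceAs (IsIso (λ_ _).hom)

instance (P : CoSeg.{w} M) : IsIso (rightUnitorHom P) :=
  isIso_of_bijective _ (fun A => (A, PUnit.unit)) (fun _ => rfl) (fun _ => rfl)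
    fun _ => inferInstanceAs (IsIso (ρ_ _).hom)

/-- The symmetry isomorphism. -/
def braidingIso (P Q : CoSeg.{w} M) : tensorObj P Q ≅ tensorObj Q P where
  hom := braidingHom P Q
  inv := braidingHom Q P
  hom_inv_id := hom_ext rfl fun s => heq_of_eq (SymmetricCategory.symmetry
    (P.F.val (s.map Prod.fst)) (Q.F.val (s.map Prod.snd)))
  inv_hom_id := hom_ext rfl fun s => heq_of_eq (SymmetricCategory.symmetry
    (Q.F.val (s.map Prod.fst)) (P.F.val (s.map Prod.snd)))

/-- The data of the monoidal category of unital precategories. -/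
noncomputable abbrev monoidalStruct : MonoidalCategoryStruct (CoSeg.{w} M) :=
  tensorStruct (fun P Q R => asIso (assocHom P Q R)) (fun P => asIso (leftUnitorHom P))
    (fun P => asIso (rightUnitorHom P))

/-- The monoidal category of unital precategories. -/
noncomputable abbrev monoidalCategory : MonoidalCategory (CoSeg.{w} M) :=
  { (monoidalStruct : MonoidalCategoryStruct (CoSeg.{w} M)) with
    tensorHom_def := fun σ τ => hom_ext rfl fun s => heq_of_eq (by
      refine Eq.trans ?_ (tensorHom_comp_tensorHom _ _ _ _).symm
      exact congrArg₂ _ (Category.comp_id _).symm (Category.id_comp _).symm)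
    id_tensorHom_id := fun P Q => hom_ext rfl fun s => heq_of_eq (id_tensorHom_id _ _)
    tensorHom_comp_tensorHom := fun _ _ _ _ => hom_ext rfl fun s =>
      heq_of_eq (tensorHom_comp_tensorHom _ _ _ _)
    whiskerLeft_id := fun P Q => hom_ext rfl fun s => heq_of_eq (id_tensorHom_id _ _)
    id_whiskerRight := fun P Q => hom_ext rfl fun s => heq_of_eq (id_tensorHom_id _ _)
    associator_naturality := fun _ _ _ => hom_ext rfl fun s =>
      heq_of_eq (associator_naturality _ _ _)
    leftUnitor_naturality := fun σ => hom_ext rfl fun s =>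
      heq_of_eq ((congrArg (· ≫ _) (id_tensorHom _ _)).trans (leftUnitor_naturality (σ.nat.app _)))
    rightUnitor_naturality := fun σ => hom_ext rfl fun s =>
      heq_of_eq ((congrArg (· ≫ _) (tensorHom_id _ _)).trans (rightUnitor_naturality (σ.nat.app _)))
    pentagon := fun P Q R S => hom_ext rfl fun s => heq_of_eq (by
      have h := pentagon (P.F.val (s.map fun A => A.1.1.1)) (Q.F.val (s.map fun A => A.1.1.2))
        (R.F.val (s.map fun A => A.1.2)) (S.F.val (s.map fun A => A.2))
      -- Whiskering of precategories is defined as tensoring with an identity, so the axiom of `M`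
      -- is put in that form.
      rw [← tensorHom_id, ← id_tensorHom] at h
      exact h)
    triangle := fun P Q => hom_ext rfl fun s => heq_of_eq (by
      have h := triangle (P.F.val (s.map fun A => A.1.1)) (Q.F.val (s.map fun A => A.2))
      rw [← tensorHom_id, ← id_tensorHom] at h
      exact h) }

theorem isMonoidal : IsMonoidal (monoidalStruct : MonoidalCategoryStruct (CoSeg.{w} M)) :=
  ⟨monoidalCategory, rfl⟩

/-- The symmetry of the monoidal category of unital precategories. -/
noncomputable abbrev symmetricCategory :
    @SymmetricCategory (CoSeg.{w} M) _ isMonoidal.monoidal :=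
  letI : MonoidalCategory (CoSeg.{w} M) := isMonoidal.monoidal
  have forward : ∀ P Q R : CoSeg.{w} M,
      (α_ P Q R).hom ≫ (braidingIso P (Q ⊗ R)).hom ≫ (α_ Q R P).hom =
        (braidingIso P Q).hom ▷ R ≫ (α_ Q P R).hom ≫ Q ◁ (braidingIso P R).hom :=
    fun P Q R => hom_ext rfl fun s => heq_of_eq (by
      have h := BraidedCategory.hexagon_forward (P.F.val (s.map fun A => A.1.1))
        (Q.F.val (s.map fun A => A.1.2)) (R.F.val (s.map fun A => A.2))
      rw [← tensorHom_id, ← id_tensorHom] at h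
      exact h)
  { braiding := braidingIso
    braiding_naturality_right := fun P _ _ σ => hom_ext rfl fun s =>
      heq_of_eq (BraidedCategory.braiding_naturality _ _)
    braiding_naturality_left := fun σ P => hom_ext rfl fun s =>
      heq_of_eq (BraidedCategory.braiding_naturality _ _)
    hexagon_forward := forward
    hexagon_reverse := fun P Q R => by
      -- The reverse hexagon is the inverse of a forward one: the inverse of `braidingIso` is by
      -- construction the braiding in the opposite order.
      have h : (α_ R P Q) ≪≫ braidingIso R (P ⊗ Q) ≪≫ α_ P Q R =
          whiskerRightIso (braidingIso R P) Q ≪≫ α_ P R Q ≪≫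
            whiskerLeftIso P (braidingIso R Q) := Iso.ext (forward R P Q)
      have h2 := congrArg Iso.inv h
      simp only [Iso.trans_inv, Category.assoc, whiskerRightIso_inv, whiskerLeftIso_inv] at h2
      exact h2
    symmetry := fun P Q => (braidingIso P Q).hom_inv_id }

end CoSeg
end CoSegal

/-! ### Constant values on chains, and the comparison of units. -/

namespace CoSegal

variable {M : Type u} [Category.{v} M] [MonoidalCategory M]

/-- A collapse never relates a chain of length zero to one of positive length, so only the two
unmixed cases occur. -/
theorem constMu_natural {n m : ℕ} (h : n = 0 ↔ m = 0) (H K : M) :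
    (eqToHom (constVal_congr h H) ⊗ₘ eqToHom (constVal_congr h K)) ≫ constMu m H K =
      constMu n H K ≫ eqToHom (constVal_congr h (H ⊗ K)) := by
  rcases n with _ | n <;> rcases m with _ | m <;> first | omega | simp [constMu]

theorem constEps_natural {n m : ℕ} (h : n = 0 ↔ m = 0) :
    𝟙 (𝟙_ M) ≫ constEps m = constEps n ≫ eqToHom (constVal_congr h (𝟙_ M)) := by
  rcases n with _ | n <;> rcases m with _ | m <;> first | omega | simp [constEps]

instance (n : ℕ) (H K : M) : IsIso (constMu n H K) := by
  cases n
  · exact inferInstanceAs (IsIso (λ_ (𝟙_ M)).hom)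
  · exact inferInstanceAs (IsIso (𝟙 _))

instance (n : ℕ) : IsIso (constEps (M := M) n) := by
  cases n
  · exact inferInstanceAs (IsIso (𝟙 (𝟙_ M)))
  · exact inferInstanceAs (IsIso (𝟙 (𝟙_ M)))

theorem constMap_id (n : ℕ) (H : M) : constMap n (𝟙 H) = 𝟙 (constVal n H) := by
  cases n <;> rfl

theorem constMu_map (n : ℕ) {H H' K K' : M} (f : H ⟶ H') (g : K ⟶ K') :
    (constMap n f ⊗ₘ constMap n g) ≫ constMu n H' K' = constMu n H K ≫ constMap n (f ⊗ₘ g) := by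
  cases n <;> simp [constMap, constMu]

theorem constMu_assoc (n : ℕ) (H K L : M) :
    (constMu n H K ⊗ₘ 𝟙 (constVal n L)) ≫ constMu n (H ⊗ K) L ≫ constMap n (α_ H K L).hom =
      (α_ _ _ _).hom ≫ (𝟙 (constVal n H) ⊗ₘ constMu n K L) ≫ constMu n H (K ⊗ L) := by
  cases n
  · simp only [constMap, constMu, tensorHom_id, id_tensorHom, Category.comp_id]
    monoidal
  · simp [constMap, constMu]

theorem constEps_leftUnitor (n : ℕ) (H : M) :
    (λ_ (constVal n H)).hom =
      (constEps n ⊗ₘ 𝟙 (constVal n H)) ≫ constMu n (𝟙_ M) H ≫ constMap n (λ_ H).hom := by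
  cases n <;> simp [constMap, constMu, constEps]

theorem constEps_rightUnitor (n : ℕ) (H : M) :
    (ρ_ (constVal n H)).hom =
      (𝟙 (constVal n H) ⊗ₘ constEps n) ≫ constMu n H (𝟙_ M) ≫ constMap n (ρ_ H).hom := by
  cases n <;> simp [constMap, constMu, constEps, unitors_equal]

/-- In all four cases the laxity map is a unitor at `I`, up to an identity transport, and the two
unitors at `I` agree. -/
theorem iotaMu_constEps (n m : ℕ) :
    (λ_ (𝟙_ M)).hom ≫ constEps (n + m) = (constEps n ⊗ₘ constEps m) ≫
      iotaMu (X := (EnrCat.unit.{w} (M := M)).X) PUnit.unit PUnit.unit PUnit.unit n m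
        (fun _ => rfl) (fun _ => rfl) := by
  have h1 : (λ_ (𝟙_ M)).hom ≫ 𝟙 (𝟙_ M) = (𝟙 (𝟙_ M) ⊗ₘ 𝟙 (𝟙_ M)) ≫ (λ_ (𝟙_ M)).hom := by simp
  have h2 : (λ_ (𝟙_ M)).hom ≫ 𝟙 (𝟙_ M) =
      (𝟙 (𝟙_ M) ⊗ₘ 𝟙 (𝟙_ M)) ≫ (λ_ (𝟙_ M)).hom ≫ 𝟙 (𝟙_ M) := by simp
  have h3 : (λ_ (𝟙_ M)).hom ≫ 𝟙 (𝟙_ M) =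
      (𝟙 (𝟙_ M) ⊗ₘ 𝟙 (𝟙_ M)) ≫ (ρ_ (𝟙_ M)).hom ≫ 𝟙 (𝟙_ M) := by simp [unitors_equal]
  rcases n with _ | n <;> rcases m with _ | m
  exacts [h1, h2, h3, h1]

/-- The canonical comparison `1 ⟶ ι(unit)`. -/
def iotaUnitHom : CoSeg.unit.{w} (M := M) ⟶ iotaObj EnrCat.unit where
  fn := id
  nat :=
    { app := fun s => constEps s.len
      naturality := fun σ => constEps_natural (Chain.len_eq_zero_iff σ)
      app_mu := fun s t => (iotaMu_constEps s.len t.len).trans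
        (congrArg (_ ≫ ·) (Category.comp_id _).symm)
      app_eps := fun _ => Category.comp_id _
      app_one := fun _ => rfl }

instance : IsIso (iotaUnitHom.{w} (M := M)) :=
  CoSeg.isIso_of_bijective _ id (fun _ => rfl) (fun _ => rfl)
    fun s => inferInstanceAs (IsIso (constEps s.len))

variable [SymmetricCategory M]

/-! ### The monoidal category of small enriched categories. -/

namespace EnrCat

/-- The associativity constraint `(C ⊠ D) ⊠ E ⟶ C ⊠ (D ⊠ E)`. -/
def assocHom (C D E : EnrCat.{w} M) :
    tensorObj (tensorObj C D) E ⟶ tensorObj C (tensorObj D E) where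
  obj A := (A.1.1, A.1.2, A.2)
  map A B := (α_ (A.1.1 ⟶[M] B.1.1) (A.1.2 ⟶[M] B.1.2) (A.2 ⟶[M] B.2)).hom
  map_id A := unit_tensor_assoc (eId M A.1.1) (eId M A.1.2) (eId M A.2)
  map_comp A B B' := (Category.assoc _ _ _).trans
    (tensorμ_assoc_lax (eComp M A.1.1 B.1.1 B'.1.1) (eComp M A.1.2 B.1.2 B'.1.2)
      (eComp M A.2 B.2 B'.2))

/-- The left unit constraint. -/
def leftUnitorHom (C : EnrCat.{w} M) : tensorObj unit C ⟶ C where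
  obj := Prod.snd
  map A B := (λ_ (A.2 ⟶[M] B.2)).hom
  map_id A := unit_tensor_leftUnitor (eId M A.2)
  map_comp A B B' := tensorμ_leftUnitor_lax (eComp M A.2 B.2 B'.2)

/-- The right unit constraint. -/
def rightUnitorHom (C : EnrCat.{w} M) : tensorObj C unit ⟶ C where
  obj := Prod.fst
  map A B := (ρ_ (A.1 ⟶[M] B.1)).hom
  map_id A := unit_tensor_rightUnitor (eId M A.1)
  map_comp A B B' := tensorμ_rightUnitor_lax (eComp M A.1 B.1 B'.1)

instance (C D E : EnrCat.{w} M) : IsIso (assocHom C D E) :=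
  isIso_of_bijective _ (fun A => ((A.1, A.2.1), A.2.2)) (fun _ => rfl) (fun _ => rfl)
    fun _ _ => inferInstanceAs (IsIso (α_ _ _ _).hom)

instance (C : EnrCat.{w} M) : IsIso (leftUnitorHom C) :=
  isIso_of_bijective _ (fun A => (PUnit.unit, A)) (fun _ => rfl) (fun _ => rfl)
    fun _ _ => inferInstanceAs (IsIso (λ_ _).hom)

instance (C : EnrCat.{w} M) : IsIso (rightUnitorHom C) :=
  isIso_of_bijective _ (fun A => (A, PUnit.unit)) (fun _ => rfl) (fun _ => rfl)
    fun _ _ => inferInstanceAs (IsIso (ρ_ _).hom)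

/-- The data of the monoidal category of small `M`-categories. -/
noncomputable abbrev monoidalStruct : MonoidalCategoryStruct (EnrCat.{w} M) :=
  tensorStruct (fun C D E => asIso (assocHom C D E)) (fun C => asIso (leftUnitorHom C))
    (fun C => asIso (rightUnitorHom C))

/-- The monoidal category of small `M`-categories. -/
noncomputable abbrev monoidalCategory : MonoidalCategory (EnrCat.{w} M) :=
  { (monoidalStruct : MonoidalCategoryStruct (EnrCat.{w} M)) with
    tensorHom_def := fun F G => hom_ext rfl fun _ _ => heq_of_eq (by
      refine Eq.trans ?_ (tensorHom_comp_tensorHom _ _ _ _).symm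
      exact congrArg₂ _ (Category.comp_id _).symm (Category.id_comp _).symm)
    id_tensorHom_id := fun _ _ => hom_ext rfl fun _ _ => heq_of_eq (id_tensorHom_id _ _)
    tensorHom_comp_tensorHom := fun _ _ _ _ => hom_ext rfl fun _ _ =>
      heq_of_eq (tensorHom_comp_tensorHom _ _ _ _)
    whiskerLeft_id := fun _ _ => hom_ext rfl fun _ _ => heq_of_eq (id_tensorHom_id _ _)
    id_whiskerRight := fun _ _ => hom_ext rfl fun _ _ => heq_of_eq (id_tensorHom_id _ _)
    associator_naturality := fun _ _ _ => hom_ext rfl fun _ _ =>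
      heq_of_eq (associator_naturality _ _ _)
    leftUnitor_naturality := fun F => hom_ext rfl fun _ _ =>
      heq_of_eq ((congrArg (· ≫ _) (id_tensorHom _ _)).trans (leftUnitor_naturality (F.map _ _)))
    rightUnitor_naturality := fun F => hom_ext rfl fun _ _ =>
      heq_of_eq ((congrArg (· ≫ _) (tensorHom_id _ _)).trans (rightUnitor_naturality (F.map _ _)))
    pentagon := fun C D E G => hom_ext rfl fun A B => heq_of_eq (by
      have h := pentagon (A.1.1.1 ⟶[M] B.1.1.1) (A.1.1.2 ⟶[M] B.1.1.2)
        (A.1.2 ⟶[M] B.1.2) (A.2 ⟶[M] B.2)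
      rw [← tensorHom_id, ← id_tensorHom] at h
      exact h)
    triangle := fun C D => hom_ext rfl fun A B => heq_of_eq (by
      have h := triangle (A.1.1 ⟶[M] B.1.1) (A.2 ⟶[M] B.2)
      rw [← tensorHom_id, ← id_tensorHom] at h
      exact h) }

theorem isMonoidal : IsMonoidal (monoidalStruct : MonoidalCategoryStruct (EnrCat.{w} M)) :=
  ⟨monoidalCategory, rfl⟩

end EnrCat

/-! ### Strong monoidality of the inclusion. -/

section Comparison

/-- For two positive lengths this is the definition of composition in `⊠`. If one length is zero it
is the unitality of `tensorμ`, and if both are, the monoidality of the left unitor at `I`. -/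
theorem iotaMu_constMu {X Y : Type w} [EnrichedCategory M X] [EnrichedCategory M Y]
    (A B C : X × Y) (n m : ℕ) (hn : n = 0 → A = B) (hm : m = 0 → B = C) :
    (tensorμ _ _ _ _ ≫
      (iotaMu A.1 B.1 C.1 n m (fun e => congrArg _ (hn e)) (fun e => congrArg _ (hm e)) ⊗ₘ
        iotaMu A.2 B.2 C.2 n m (fun e => congrArg _ (hn e)) (fun e => congrArg _ (hm e)))) ≫
      constMu (n + m) (A.1 ⟶[M] C.1) (A.2 ⟶[M] C.2) =
    (constMu n (A.1 ⟶[M] B.1) (A.2 ⟶[M] B.2) ⊗ₘ constMu m (B.1 ⟶[M] C.1) (B.2 ⟶[M] C.2)) ≫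
      iotaMu A B C n m hn hm := by
  rcases n with _ | n
  · obtain rfl := hn rfl
    rcases m with _ | m
    · obtain rfl := hm rfl
      exact tensorμ_leftUnitor_lax _
    · have h := tensor_left_unitality (A.1 ⟶[M] C.1) (A.2 ⟶[M] C.2)
      simp only [iotaMu, constMu, eqToHom_refl, Category.comp_id, tensorHom_id]
      -- The unitor of the product expands to a composite beginning with the whiskered inverse
      -- unitor of `I`, which cancels against `constMu 0`.
      erw [h]
      rw [hom_inv_whiskerRight_assoc]
  · rcases m with _ | m
    · obtain rfl := hm rfl
      have h := tensor_right_unitality (A.1 ⟶[M] B.1) (A.2 ⟶[M] B.2)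
      simp only [iotaMu, constMu, eqToHom_refl, Category.comp_id, id_tensorHom]
      erw [h]
      rw [whiskerLeft_hom_inv_assoc]
    · simp only [iotaMu, constMu, Category.comp_id, id_tensorHom_id, Category.id_comp]
      rfl

/-- The canonical comparison `ι(C) ⊗_S ι(D) ⟶ ι(C ⊠ D)`. -/
def iotaTensorHom (C D : EnrCat.{w} M) :
    CoSeg.tensorObj (iotaObj C) (iotaObj D) ⟶ iotaObj (EnrCat.tensorObj C D) where
  fn := id
  nat :=
    { app := fun {A B : C.X × D.X} (s : Chain A B) => constMu s.len (A.1 ⟶[M] B.1) (A.2 ⟶[M] B.2)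
      naturality := fun σ => constMu_natural (Chain.len_eq_zero_iff σ) _ _
      app_mu := fun {A B E : C.X × D.X} (s : Chain A B) (t : Chain B E) => by
        refine Eq.trans ?_ ((iotaMu_constMu A B E s.len t.len s.eq_of_len t.eq_of_len).trans
          (congrArg (_ ≫ ·) (Category.comp_id _).symm))
        exact congrArg₂ (fun f g => (tensorμ _ _ _ _ ≫ (f ⊗ₘ g)) ≫ constMu _ _ _)
          (Category.comp_id _) (Category.comp_id _)
      app_eps := fun A => by
        refine (Category.assoc _ _ _).trans ?_
        refine (congrArg (_ ≫ ·) ((congrArg (· ≫ _) (id_tensorHom_id _ _)).trans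
          (Category.id_comp _))).trans ?_
        exact Iso.inv_hom_id _
      app_one := fun A => by
        refine (Category.comp_id _).trans ?_
        refine Eq.trans ?_ (Category.comp_id _).symm
        exact congrArg₂ (fun f g => (λ_ (𝟙_ M)).inv ≫ (f ⊗ₘ g))
          (Category.comp_id _) (Category.comp_id _) }

instance (C D : EnrCat.{w} M) : IsIso (iotaTensorHom C D) :=
  CoSeg.isIso_of_bijective _ id (fun _ => rfl) (fun _ => rfl)
    fun {A B : C.X × D.X} (s : Chain A B) =>
      inferInstanceAs (IsIso (constMu s.len (A.1 ⟶[M] B.1) (A.2 ⟶[M] B.2)))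

/-- The inclusion of `M`-categories is lax monoidal. -/
noncomputable abbrev iotaLaxMonoidal :
    letI : MonoidalCategory (CoSeg.{w} M) := CoSeg.isMonoidal.monoidal
    letI : MonoidalCategory (EnrCat.{w} M) := EnrCat.isMonoidal.monoidal
    (iota : EnrCat.{w} M ⥤ CoSeg.{w} M).LaxMonoidal :=
  letI : MonoidalCategory (CoSeg.{w} M) := CoSeg.isMonoidal.monoidal
  letI : MonoidalCategory (EnrCat.{w} M) := EnrCat.isMonoidal.monoidal
  { ε := iotaUnitHom
    μ := iotaTensorHom
    μ_natural_left := fun {C D} F E => CoSeg.hom_ext rfl fun {A B : C.X × E.X} (s : Chain A B) => heq_of_eq (by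
      have h := constMu_map s.len (F.map A.1 B.1) (𝟙 (A.2 ⟶[M] B.2))
      rw [constMap_id] at h
      exact h)
    μ_natural_right := fun {C D} E F => CoSeg.hom_ext rfl fun {A B : E.X × C.X} (s : Chain A B) => heq_of_eq (by
      have h := constMu_map s.len (𝟙 (A.1 ⟶[M] B.1)) (F.map A.2 B.2)
      rw [constMap_id] at h
      exact h)
    associativity := fun C D E =>
      CoSeg.hom_ext rfl fun {A B : (C.X × D.X) × E.X} (s : Chain A B) =>
      heq_of_eq (constMu_assoc s.len (A.1.1 ⟶[M] B.1.1) (A.1.2 ⟶[M] B.1.2) (A.2 ⟶[M] B.2))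
    left_unitality := fun C => CoSeg.hom_ext rfl fun {A B : PUnit × C.X} (s : Chain A B) =>
      heq_of_eq (constEps_leftUnitor s.len (A.2 ⟶[M] B.2))
    right_unitality := fun C => CoSeg.hom_ext rfl fun {A B : C.X × PUnit} (s : Chain A B) =>
      heq_of_eq (constEps_rightUnitor s.len (A.1 ⟶[M] B.1)) }

end Comparison

end CoSegal

theorem mainTheorem12 (M : Type u) [Category.{v} M] [MonoidalCategory M] [SymmetricCategory M] :
    (∀ X Y : Type w, SOp.IsFibreProduct X Y) ∧
    ∃ (a : ∀ P Q R : CoSeg.{w} M, CoSeg.tensorObj (CoSeg.tensorObj P Q) R ≅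
          CoSeg.tensorObj P (CoSeg.tensorObj Q R))
      (l : ∀ P : CoSeg.{w} M, CoSeg.tensorObj CoSeg.unit P ≅ P)
      (r : ∀ P : CoSeg.{w} M, CoSeg.tensorObj P CoSeg.unit ≅ P)
      (b : ∀ P Q : CoSeg.{w} M, CoSeg.tensorObj P Q ≅ CoSeg.tensorObj Q P)
      (hC : IsMonoidal (CoSeg.tensorStruct a l r)),
      (∀ P Q R, CoSeg.Hom.Is (a P Q R).hom (fun A => (A.1.1, A.1.2, A.2)) fun s =>
        (α_ (P.F.val (s.map fun A => A.1.1)) (Q.F.val (s.map fun A => A.1.2))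
          (R.F.val (s.map fun A => A.2))).hom) ∧
      (∀ P, CoSeg.Hom.Is (l P).hom Prod.snd fun s => (λ_ (P.F.val (s.map Prod.snd))).hom) ∧
      (∀ P, CoSeg.Hom.Is (r P).hom Prod.fst fun s => (ρ_ (P.F.val (s.map Prod.fst))).hom) ∧
      (∀ P Q, CoSeg.Hom.Is (b P Q).hom Prod.swap fun s =>
        (β_ (P.F.val (s.map Prod.fst)) (Q.F.val (s.map Prod.snd))).hom) ∧
      (letI := hC.monoidal
        ∃ S : SymmetricCategory (CoSeg.{w} M), ∀ P Q, S.braiding P Q = b P Q) ∧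
      ∃ (a' : ∀ C D E : EnrCat.{w} M, EnrCat.tensorObj (EnrCat.tensorObj C D) E ≅
            EnrCat.tensorObj C (EnrCat.tensorObj D E))
        (l' : ∀ C : EnrCat.{w} M, EnrCat.tensorObj EnrCat.unit C ≅ C)
        (r' : ∀ C : EnrCat.{w} M, EnrCat.tensorObj C EnrCat.unit ≅ C)
        (hE : IsMonoidal (EnrCat.tensorStruct a' l' r')),
        (∀ C D E, EnrCat.HomIs (a' C D E).hom (fun A => (A.1.1, A.1.2, A.2)) fun A B =>
          (α_ (A.1.1 ⟶[M] B.1.1) (A.1.2 ⟶[M] B.1.2) (A.2 ⟶[M] B.2)).hom) ∧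
        (∀ C, EnrCat.HomIs (l' C).hom Prod.snd fun A B => (λ_ (A.2 ⟶[M] B.2)).hom) ∧
        (∀ C, EnrCat.HomIs (r' C).hom Prod.fst fun A B => (ρ_ (A.1 ⟶[M] B.1)).hom) ∧
        letI := hC.monoidal
        letI := hE.monoidal
        ∃ T : (iota : EnrCat.{w} M ⥤ CoSeg.{w} M).Monoidal,
          CoSeg.Hom.Is (Functor.LaxMonoidal.ε iota) id (fun s => constEps (M := M) s.len) ∧
          ∀ C D : EnrCat.{w} M, CoSeg.Hom.Is (Functor.LaxMonoidal.μ iota C D) id fun {A B} s =>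
            constMu s.len (EnrichedCategory.Hom (V := M) (C := C.X) A.1 B.1)
              (EnrichedCategory.Hom (V := M) (C := D.X) A.2 B.2) := by
  refine ⟨SOp.isFibreProduct, fun P Q R => asIso (CoSeg.assocHom P Q R),
    fun P => asIso (CoSeg.leftUnitorHom P), fun P => asIso (CoSeg.rightUnitorHom P),
    CoSeg.braidingIso, CoSeg.isMonoidal, fun _ _ _ => ⟨_, rfl, fun _ => rfl⟩,
    fun _ => ⟨_, rfl, fun _ => rfl⟩, fun _ => ⟨_, rfl, fun _ => rfl⟩,
    fun _ _ => ⟨_, rfl, fun _ => rfl⟩, ⟨CoSeg.symmetricCategory, fun _ _ => rfl⟩,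
    fun C D E => asIso (EnrCat.assocHom C D E),
    fun C => asIso (EnrCat.leftUnitorHom C), fun C => asIso (EnrCat.rightUnitorHom C),
    EnrCat.isMonoidal, fun _ _ _ => ⟨_, _, rfl⟩, fun _ => ⟨_, _, rfl⟩, fun _ => ⟨_, _, rfl⟩, ?_⟩
  let _ : MonoidalCategory (CoSeg.{w} M) := CoSeg.isMonoidal.monoidal
  let _ : MonoidalCategory (EnrCat.{w} M) := EnrCat.isMonoidal.monoidal
  -- A lax structure with invertible unit and tensor comparisons is strong, so only these two
  -- invertibility facts remain.
  let _ := iotaLaxMonoidal.{w} (M := M)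
  have : IsIso (Functor.LaxMonoidal.ε (iota : EnrCat.{w} M ⥤ CoSeg.{w} M)) :=
    inferInstanceAs (IsIso iotaUnitHom)
  have : ∀ C D, IsIso (Functor.LaxMonoidal.μ (iota : EnrCat.{w} M ⥤ CoSeg.{w} M) C D) :=
    fun C D => inferInstanceAs (IsIso (iotaTensorHom C D))
  exact ⟨Functor.Monoidal.ofLaxMonoidal iota, ⟨_, rfl, fun _ => rfl⟩,
    fun _ _ => ⟨_, rfl, fun _ => rfl⟩⟩
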